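/- Notation. Let $\mathbb{C}_+=\{z\in\mathbb{C}:\operatorname{Re}z>0\}$, and for $a\in\mathbb{C}_+$ let $Q(a)=\{x+iy:\ 0\le x<2\operatorname{Re}a,\ |y-\operatorname{Im}a|\le\operatorname{Re}a\}$ be the Carleson square centred at $a$. Let $0\le m\le\infty$, and for each integer $n$ with $0\le n\le m$ let $\tilde\nu_n$ be a positive regular Borel measure on $[0,\infty)$ with $\tilde\nu_n[0,r)>0$ for all $r>0$ and $\sup_{r>0}\tilde\nu_n[0,2r)/\tilde\nu_n[0,r)<\infty$; put $\nu_n=\tilde\nu_n\otimes\lambda$ on $\overline{\mathbb{C}_+}=[0,\infty)\times i\mathbb{R}$, where $\lambda$ is Lebesgue measure on $i\mathbb{R}$. For $1\le p<\infty$ let $A^p(\mathbb{C}_+,(\nu_n)_{n=0}^m)$ be the space of analytic $F:\mathbb{C}_+\to\mathbb{C}$ with $$\|F\|^p:=\sum_{n=0}^m\ \sup_{\varepsilon>0}\int_{\overline{\mathbb{C}_+}}|F^{(n)}(z+\varepsilon)|^p\,d\nu_n(z)<\infty .$$ A measurable function $\rho:\mathbb{C}_+\to(0,\infty)$ is called a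 regular weight if for every $\varepsilon>0$ there is $\delta>0$ such that $\rho(z_1)\le\delta\rho(z_2)$ whenever the (Poincaré) hyperbolic distance of $z_1,z_2$ in $\mathbb{C}_+$ is at most $\varepsilon$. For $1<s<\infty$ let $s'=s/(s-1)$, and let $dz$ denote area measure. Theorem. Let $1<p\le q<\infty$, let $\mu$ be a positive Borel measure on $\mathbb{C}_+$ with $\mu(Q(a))<\infty$ for all $a\in\mathbb{C}_+$, and let $\rho$ be a regular weight such that $$\int_{\mathbb{C}_+}|F'(z)|^p(\operatorname{Re}z)^{p-2}\rho(z)\,dz\le\|F\|^p\qquad\text{for all }F\in A^p(\mathbb{C}_+,(\nu_n)_{n=0}^m).$$ Suppose that there is a constant $C>0$ such that $$\left(\int_{Q(a)}\frac{\mu(Q(a)\cap Q(z))^{p'}}{(\operatorname{Re}z)^2}\,\rho(z)^{1-p'}\,dz\right)^{q'/p'}\le C\,\mu(Q(a))\qquad\text{for all }a\in\mathbb{C}_+.$$ Then the embedding $A^p(\mathbb{C}_+,(\nu_n)_{n=0}^m)\hookrightarrow L^q(\mathbb{C}_+,\mu)$ is bounded, i.e. there is a constant $K$ with $\left(\int_{\mathbb{C}_+}|F|^q\,d\mu\right)^{1/q}\le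 K\|F\|$ for all $F\in A^p(\mathbb{C}_+,(\nu_n)_{n=0}^m)$. -/

import Mathlib

open MeasureTheory Set
open scoped NNReal ENNReal

/-- The open right complex half-plane `ℂ₊`. -/
def rightHalfPlane : Set ℂ := {z | 0 < z.re}

/-- The Carleson square `Q(a)` centred at `a`. -/
def carlesonSquare (a : ℂ) : Set ℂ :=
  {z | 0 ≤ z.re ∧ z.re < 2 * a.re ∧ |z.im - a.im| ≤ a.re}

/-- A positive regular Borel measure on `[0, ∞)` with the `Δ₂`-condition
`sup_{r > 0} ν[0, 2r) / ν[0, r) < ∞`; for the quotients to make sense, `ν[0, r)` is nonzero.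
(In `ℝ≥0` the set `Iio r` is the interval `[0, r)`.) -/
structure IsDelta2Measure (ν : Measure ℝ≥0) : Prop where
  regular : ν.Regular
  ne_zero : ∀ r : ℝ≥0, 0 < r → ν (Iio r) ≠ 0
  doubling : ∃ R : ℝ≥0, ∀ r : ℝ≥0, 0 < r → ν (Iio (2 * r)) ≤ R * ν (Iio r)

/-- `sup_{ε > 0} ∫ |F (z + ε)|^p d(ν ⊗ λ)(z)`, the `p`-th power of the norm of the Zen space
`A^p_{ν ⊗ λ}`; the integral is over the closed half-plane `[0, ∞) × iℝ`, whose points are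
written `x + i y` with `(x, y) : ℝ≥0 × ℝ`. -/
noncomputable def zenNormPow (p : ℝ) (ν : Measure ℝ≥0) (F : ℂ → ℂ) : ℝ≥0∞ :=
  ⨆ (ε : ℝ) (_ : 0 < ε),
    ∫⁻ w : ℝ≥0 × ℝ, ‖F ((⟨(w.1 : ℝ), w.2⟩ : ℂ) + (ε : ℂ))‖ₑ ^ p ∂(ν.prod volume)

/-- `∑_{n=0}^m ‖F^{(n)}‖^p`, the `p`-th power of the norm of `A^p(ℂ₊, (ν_n)_{n=0}^m)`, where
`0 ≤ m ≤ ∞`. -/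
noncomputable def genZenNormPow (p : ℝ) (m : ℕ∞) (ν : ℕ → Measure ℝ≥0) (F : ℂ → ℂ) : ℝ≥0∞ :=
  ∑' n : {n : ℕ // (n : ℕ∞) ≤ m}, zenNormPow p (ν n) (iteratedDeriv n F)

/-- The norm of `A^p(ℂ₊, (ν_n)_{n=0}^m)`. -/
noncomputable def genZenNorm (p : ℝ) (m : ℕ∞) (ν : ℕ → Measure ℝ≥0) (F : ℂ → ℂ) : ℝ≥0∞ :=
  genZenNormPow p m ν F ^ (1 / p)

/-- The space `A^p(ℂ₊, (ν_n)_{n=0}^m)`: functions analytic on `ℂ₊` with finite norm. A function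
on `ℂ₊` is represented by a function on `ℂ` whose values off `ℂ₊` play no role. -/
def genZenSpace (p : ℝ) (m : ℕ∞) (ν : ℕ → Measure ℝ≥0) : Set (ℂ → ℂ) :=
  {F | DifferentiableOn ℂ F rightHalfPlane ∧ genZenNormPow p m ν F < ∞}

/-- The Poincaré hyperbolic distance of the right half-plane:
`cosh d = 1 + |z - w|² / (2 Re z Re w)`, i.e. `sinh (d / 2) = |z - w| / (2 √(Re z Re w))`. -/
noncomputable def halfPlaneDist (z w : ℂ) : ℝ :=
  2 * Real.arsinh (‖z - w‖ / (2 * Real.sqrt (z.re * w.re)))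

/-- A regular weight on `ℂ₊`: positive, measurable, and for each `ε` comparable, with one
constant, at any two points of hyperbolic distance at most `ε`. -/
structure IsRegularWeight (ρ : ℂ → ℝ) : Prop where
  pos : ∀ z ∈ rightHalfPlane, 0 < ρ z
  measurable : Measurable fun z : rightHalfPlane => ρ z
  comparable : ∀ ε : ℝ, 0 < ε → ∃ δ : ℝ, 0 < δ ∧
    ∀ z ∈ rightHalfPlane, ∀ w ∈ rightHalfPlane, halfPlaneDist z w ≤ ε → ρ z ≤ δ * ρ w

/-! The proof discretises the embedding to a weighted tree of dyadic Carleson boxes.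

The mass of `ν 0` near the boundary and the sub-mean value property force F to tend to 0 along
horizontal lines (`tendsto_zero_of_zenNormPow_lt_top`). Telescoping from z to infinity through
dyadic scales then bounds |F(z)| by the sum, over the boxes containing z, of coefficients G_i = side
length times an L^p mean of F' near the top half (`enorm_le_tsum_dyadicCoeff`). These neighbourhoods
overlap boundedly and ρ is nearly constant on each, so the Besov hypothesis bounds Σ G_i^p ρ_i by
‖F‖^p (`exists_sum_dyadicCoeff_rpow_le`). It remains to bound f = Σ G_i 1_{E_i} in L^q(μ), where E_i
are the boxes.

This is `lintegral_tree_sum_rpow_le`. Let S_i be the sum of G_j over E_j ⊇ E_i, A = ∫ f^q dμ and B =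
Σ G_i S_i^{q-1} μ(E_i). A discrete chain rule gives A ≤ qB, and S_i ≤ f on E_i gives B ≤ A. Hölder
with the weights separates Σ G_i^p w_i from Σ c_i S_i^σ, where c_i = μ(E_i)^{p'} w_i^{1-p'} and σ =
(q-1)p'. Applying the chain rule to S_i^σ and exchanging sums leaves Σ c_i over E_i ⊆ E_j, which the
testing condition controls. With Chebyshev, S_j^q μ(E_j) ≤ A, the second factor is at most a
constant times A^{p'/q'}. Hence A ≤ const · N · A^{1/q'} with N = (Σ G_i^p w_i)^{1/p}, and dividing
by A^{1/q'} finishes. -/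

/-! ### Discrete chain rule for powers of sums. -/

/-- One step of Abel's summation for the power function. -/
theorem ENNReal.add_rpow_le_rpow_add_mul (S g : ℝ≥0∞) {r : ℝ} (hr : 1 ≤ r) :
    (S + g) ^ r ≤ S ^ r + ENNReal.ofReal r * (g * (S + g) ^ (r - 1)) := by
  have hr0 : 0 < r := by linarith
  rcases eq_or_ne S ∞ with rfl | hS
  · simp [ENNReal.top_rpow_of_pos hr0]
  rcases eq_or_ne g 0 with rfl | hg0
  · simp
  rcases eq_or_ne g ∞ with rfl | hg
  · rcases hr.eq_or_lt with rfl | h1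
    · simp
    · rw [add_top, ENNReal.top_rpow_of_pos (by linarith : 0 < r - 1), ENNReal.top_mul_top,
        ENNReal.mul_top (by simpa using hr0), add_top]
      exact le_top
  lift S to ℝ≥0 using hS
  lift g to ℝ≥0 using hg
  have hg0' : 0 < g := by
    rw [pos_iff_ne_zero]
    exact_mod_cast hg0
  have hT : 0 < S + g := by positivity
  rw [← ENNReal.coe_add, ← ENNReal.coe_rpow_of_nonneg _ hr0.le,
    ← ENNReal.coe_rpow_of_nonneg _ hr0.le, ← ENNReal.coe_rpow_of_nonneg _ (by linarith),
    ENNReal.ofReal]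
  norm_cast
  rw [← NNReal.coe_le_coe]
  push_cast
  rw [Real.coe_toNNReal _ hr0.le]
  have hT' : (0 : ℝ) < S + g := by exact_mod_cast hT
  have hg1 : (g : ℝ) / (S + g) ≤ 1 := (div_le_one hT').2 (by simp)
  -- Bernoulli's inequality for (S / (S + g))^r, to be multiplied by (S + g)^r.
  have key := one_add_mul_self_le_rpow_one_add (s := -((g : ℝ) / (S + g))) (by linarith) hr
  have e1 : (1 : ℝ) + -((g : ℝ) / (S + g)) = S / (S + g) := by field_simp; ring
  rw [e1, Real.div_rpow (by positivity) hT'.le, le_div_iff₀ (by positivity)] at key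
  have e2 : ((S : ℝ) + g) ^ r = (S + g) * (S + g) ^ (r - 1) := by
    rw [Real.rpow_sub_one hT'.ne']; field_simp
  have e3 : (1 + r * -((g : ℝ) / (S + g))) * ((S : ℝ) + g) ^ r
      = (S + g) ^ r - r * (g * (S + g) ^ (r - 1)) := by
    rw [e2]; field_simp; ring
  linarith

/-- A discrete chain rule: for `r ≥ 1`, the `r`-th power of a sum is bounded by `r` times the sum
of the terms weighted by powers of the partial sums. -/
theorem ENNReal.sum_rpow_le_sum_mul_partialSum {ι α : Type*} [LinearOrder α] (rank : ι → α)
    (s : Finset ι) (G : ι → ℝ≥0∞) {r : ℝ} (hr : 1 ≤ r) :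
    (∑ i ∈ s, G i) ^ r ≤ ENNReal.ofReal r *
      ∑ i ∈ s, G i * (∑ j ∈ s with rank i ≤ rank j, G j) ^ (r - 1) := by
  classical
  have hr0 : 0 < r := by linarith
  -- The partial sum of an element of least rank is the whole sum; inserting it can only enlarge the
  -- other partial sums.
  induction s using Finset.induction_on_min_value rank with
  | empty => simp [ENNReal.zero_rpow_of_pos hr0]
  | insert a s ha hmin ih =>
    rw [Finset.sum_insert ha, Finset.sum_insert ha, add_comm]
    refine (ENNReal.add_rpow_le_rpow_add_mul _ _ hr).trans ?_
    rw [mul_add, add_comm]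
    gcongr ?_ + ?_
    · have : (insert a s).filter (fun j => rank a ≤ rank j) = insert a s := by
        rw [Finset.filter_eq_self]
        intro x hx
        rcases Finset.mem_insert.1 hx with rfl | hx
        · exact le_rfl
        · exact hmin x hx
      rw [this, Finset.sum_insert ha, add_comm (G a)]
    · refine ih.trans ?_
      have : 0 ≤ r - 1 := by linarith
      gcongr
      exact Finset.subset_insert _ _

/-! ### Embedding theorem for laminar families. -/

section Tree

variable {ι X : Type*} [MeasurableSpace X]

/-- **Embedding theorem for weighted trees.** A finite sum over a laminar family of sets, whose
weights satisfy a testing condition on each set of the family, defines a bounded map from weighted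
`ℓ^p` to `L^q(μ)`. -/
theorem lintegral_tree_sum_rpow_le {α : Type*} [LinearOrder α] {p q : ℝ} (hp : 1 < p)
    (hpq : p ≤ q) (μ : Measure X) (E : ι → Set X) (rank : ι → α)
    (hEm : ∀ i, MeasurableSet (E i)) (hEne : ∀ i, (E i).Nonempty) (hEfin : ∀ i, μ (E i) ≠ ∞)
    (hlam : ∀ i j x, x ∈ E i → x ∈ E j → rank i ≤ rank j → E i ⊆ E j)
    (w : ι → ℝ≥0∞) (hw0 : ∀ i, w i ≠ 0) (hwtop : ∀ i, w i ≠ ∞) (C : ℝ≥0∞)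
    (htest : ∀ (s : Finset ι) (i : ι), (∀ j ∈ s, E j ⊆ E i) →
      ∑ j ∈ s, μ (E j) ^ p.conjExponent * w j ^ (1 - p.conjExponent)
        ≤ C * μ (E i) ^ (p.conjExponent / q.conjExponent))
    (s : Finset ι) (G : ι → ℝ≥0∞) (hG : ∀ i, G i ≠ ∞) :
    (∫⁻ x, (∑ i ∈ s, (E i).indicator (fun _ => G i) x) ^ q ∂μ) ^ (1 / q)
      ≤ ENNReal.ofReal q * (ENNReal.ofReal ((q - 1) * p.conjExponent) * C) ^ (1 / p.conjExponent)
        * (∑ i ∈ s, G i ^ p * w i) ^ (1 / p) := by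
  classical
  have hq : 1 < q := by linarith
  have hq0 : 0 < q := by linarith
  have hp0 : 0 < p := by linarith
  have hconj : p.HolderConjugate p.conjExponent := Real.HolderConjugate.conjExponent hp
  have hqconj : q.HolderConjugate q.conjExponent := Real.HolderConjugate.conjExponent hq
  set p' := p.conjExponent with hp'
  set q' := q.conjExponent with hq'
  have hp'0 : 0 < p' := hconj.symm.pos
  have hq'0 : 0 < q' := hqconj.symm.pos
  have hp'v : p' = p / (p - 1) := rfl
  have hq'v : q' = q / (q - 1) := rfl
  set σ := (q - 1) * p' with hσ
  -- Here and in `hθ`, p ≤ q is what makes the exponents admissible: σ ≥ 1 for the chain rule, p'/q'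
  -- ≥ 1 for raising Chebyshev's bound to a nonnegative power.
  have hσ1 : 1 ≤ σ := by
    rw [hσ, hp'v, mul_div_assoc', le_div_iff₀ (by linarith)]
    nlinarith
  have hσ0 : 0 < σ := by linarith
  have hθ : 0 ≤ p' / q' - 1 := by
    rw [hp'v, hq'v, sub_nonneg, le_div_iff₀ (by have := hq'0; rwa [hq'v] at this), one_mul,
      div_le_div_iff₀ (by linarith) (by linarith)]
    nlinarith
  have hσθ : σ - 1 = (q - 1) + q * (p' / q' - 1) := by
    rw [hσ, hq'v]; field_simp; ring
  set f : X → ℝ≥0∞ := fun x => ∑ i ∈ s, (E i).indicator (fun _ => G i) x with hf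
  set S : ι → ℝ≥0∞ := fun i => ∑ j ∈ s with E i ⊆ E j, G j with hS
  have hfm : Measurable f :=
    Finset.measurable_sum _ fun i _ => measurable_const.indicator (hEm i)
  have hfeq : ∀ x, f x = ∑ i ∈ s with x ∈ E i, G i := fun x => by
    rw [hf, Finset.sum_filter]
    exact Finset.sum_congr rfl fun i _ => by rw [indicator_apply]
  have hSf : ∀ i, ∀ x ∈ E i, S i ≤ f x := fun i x hx => by
    rw [hfeq]
    refine Finset.sum_le_sum_of_subset fun j hj => ?_
    rw [Finset.mem_filter] at hj ⊢
    exact ⟨hj.1, hj.2 hx⟩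
  set A := ∫⁻ x, f x ^ q ∂μ with hA
  set B := ∑ i ∈ s, G i * S i ^ (q - 1) * μ (E i) with hB
  -- Finiteness is needed to divide by A^(1/q') at the end.
  have hAtop : A ≠ ∞ := by
    have hle : ∀ x, f x ^ q ≤ ∑ i ∈ s, (E i).indicator (fun _ => (∑ j ∈ s, G j) ^ q) x := by
      intro x
      by_cases hx : ∃ i ∈ s, x ∈ E i
      · obtain ⟨i, hi, hxi⟩ := hx
        refine le_trans ?_ (Finset.single_le_sum (fun _ _ => zero_le) hi)
        rw [indicator_of_mem hxi, hfeq]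
        gcongr
        exact Finset.filter_subset _ _
      · push Not at hx
        have : f x = 0 := by
          rw [hfeq, Finset.sum_eq_zero]
          intro i hi
          rw [Finset.mem_filter] at hi
          exact absurd hi.2 (hx i hi.1)
        rw [this, ENNReal.zero_rpow_of_pos hq0]
        exact zero_le
    refine ne_top_of_le_ne_top ?_ (lintegral_mono hle)
    rw [lintegral_finsetSum _ fun i _ => measurable_const.indicator (hEm i)]
    refine ENNReal.sum_ne_top.2 fun i _ => ?_
    rw [lintegral_indicator_const (hEm i)]
    exact ENNReal.mul_ne_top (ENNReal.rpow_ne_top_of_nonneg hq0.le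
      (ENNReal.sum_ne_top.2 fun j _ => hG j)) (hEfin i)
  have hint : ∫⁻ x, ∑ i ∈ s, (E i).indicator (fun _ => G i * S i ^ (q - 1)) x ∂μ = B := by
    rw [lintegral_finsetSum _ fun i _ => measurable_const.indicator (hEm i)]
    exact Finset.sum_congr rfl fun i _ => lintegral_indicator_const (hEm i) _
  -- The sets through x form a chain ordered by rank, so each partial sum in the chain rule at x is
  -- at most S i.
  have hAB : A ≤ ENNReal.ofReal q * B := by
    rw [← hint, ← lintegral_const_mul' _ _ ENNReal.ofReal_ne_top]
    refine lintegral_mono fun x => ?_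
    simp only [hfeq]
    refine (ENNReal.sum_rpow_le_sum_mul_partialSum rank _ G hq.le).trans ?_
    gcongr ENNReal.ofReal q * ?_
    simp only [indicator_apply]
    rw [← Finset.sum_filter]
    refine Finset.sum_le_sum fun i hi => ?_
    gcongr
    refine Finset.sum_le_sum_of_subset fun j hj => ?_
    simp only [Finset.mem_filter] at hi hj ⊢
    exact ⟨hj.1.1, hlam i j x hi.2 hj.1.2 hj.2⟩
  have hBA : B ≤ A := by
    rw [← hint]
    refine lintegral_mono fun x => ?_
    have : f x ^ q = ∑ i ∈ s, (E i).indicator (fun _ => G i) x * f x ^ (q - 1) := by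
      rw [← Finset.sum_mul]
      conv_lhs => rw [show q = 1 + (q - 1) by ring,
        ENNReal.rpow_add_of_nonneg _ _ zero_le_one (by linarith), ENNReal.rpow_one]
    simp only
    rw [this]
    refine Finset.sum_le_sum fun i _ => ?_
    by_cases hx : x ∈ E i
    · rw [indicator_of_mem hx, indicator_of_mem hx]
      gcongr
      exact hSf i x hx
    · simp [hx]
  have hcheb : ∀ i, S i ^ q * μ (E i) ≤ A := fun i => by
    rw [← setLIntegral_const]
    exact (setLIntegral_mono (hfm.pow_const q) fun x hx => by gcongr; exact hSf i x hx).trans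
      (setLIntegral_le_lintegral _ _)
  have hSpow : ∀ i, S i ^ σ ≤ ENNReal.ofReal σ *
      ∑ j ∈ s with E i ⊆ E j, G j * S j ^ (σ - 1) := fun i => by
    refine (ENNReal.sum_rpow_le_sum_mul_partialSum rank _ G hσ1).trans ?_
    gcongr with j hj
    -- All sets containing E i share this point, so laminarity orders them by rank.
    obtain ⟨x, hx⟩ := hEne i
    refine Finset.sum_le_sum_of_subset fun k hk => ?_
    simp only [Finset.mem_filter] at hj hk ⊢
    exact ⟨hk.1.1, hlam j k x (hj.2 hx) (hk.1.2 hx) hk.2⟩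
  set c : ι → ℝ≥0∞ := fun i => μ (E i) ^ p' * w i ^ (1 - p') with hc
  have hcS : ∑ i ∈ s, c i * S i ^ σ ≤ ENNReal.ofReal σ * C * (A ^ (p' / q' - 1) * B) := by
    calc ∑ i ∈ s, c i * S i ^ σ
        ≤ ∑ i ∈ s, c i * (ENNReal.ofReal σ * ∑ j ∈ s with E i ⊆ E j, G j * S j ^ (σ - 1)) := by
          gcongr with i hi; exact hSpow i
      _ = ENNReal.ofReal σ * ∑ j ∈ s, G j * S j ^ (σ - 1) * ∑ i ∈ s with E i ⊆ E j, c i := by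
          simp only [Finset.mul_sum, Finset.sum_filter]
          rw [Finset.sum_comm]
          refine Finset.sum_congr rfl fun j _ => Finset.sum_congr rfl fun i _ => ?_
          split_ifs
          · ring
          · simp
      _ ≤ ENNReal.ofReal σ * ∑ j ∈ s, G j * S j ^ (σ - 1) * (C * μ (E j) ^ (p' / q')) := by
          gcongr with j hj
          exact htest _ j fun i hi => (Finset.mem_filter.1 hi).2
      _ ≤ ENNReal.ofReal σ * ∑ j ∈ s, C * A ^ (p' / q' - 1) *
            (G j * S j ^ (q - 1) * μ (E j)) := by
          gcongr ENNReal.ofReal σ * ?_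
          refine Finset.sum_le_sum fun j _ => ?_
          have e : S j ^ (σ - 1) * μ (E j) ^ (p' / q')
              = (S j ^ q * μ (E j)) ^ (p' / q' - 1) * (S j ^ (q - 1) * μ (E j)) := by
            rw [hσθ, ENNReal.rpow_add_of_nonneg _ _ (by linarith) (by positivity),
              ENNReal.mul_rpow_of_nonneg _ _ hθ, ← ENNReal.rpow_mul]
            conv_lhs => rw [show p' / q' = (p' / q' - 1) + 1 by ring,
              ENNReal.rpow_add_of_nonneg _ _ hθ zero_le_one, ENNReal.rpow_one]
            ring_nf
          calc G j * S j ^ (σ - 1) * (C * μ (E j) ^ (p' / q'))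
              = G j * C * (S j ^ (σ - 1) * μ (E j) ^ (p' / q')) := by ring
            _ ≤ G j * C * (A ^ (p' / q' - 1) * (S j ^ (q - 1) * μ (E j))) := by
                rw [e]; gcongr; exact hcheb j
            _ = _ := by ring
      _ = _ := by rw [← Finset.mul_sum]; ring
  have hHolder : B ≤ (∑ i ∈ s, G i ^ p * w i) ^ (1 / p) *
      (∑ i ∈ s, c i * S i ^ σ) ^ (1 / p') := by
    have h := ENNReal.inner_le_Lp_mul_Lq s (fun i => G i * w i ^ (1 / p))
      (fun i => S i ^ (q - 1) * μ (E i) * w i ^ (-(1 / p))) hconj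
    refine (le_of_eq ?_).trans (h.trans (le_of_eq ?_))
    · refine Finset.sum_congr rfl fun i _ => ?_
      have : w i ^ (1 / p) * w i ^ (-(1 / p)) = 1 := by
        rw [← ENNReal.rpow_add _ _ (hw0 i) (hwtop i)]; simp
      calc G i * S i ^ (q - 1) * μ (E i)
          = G i * S i ^ (q - 1) * μ (E i) * (w i ^ (1 / p) * w i ^ (-(1 / p))) := by
            rw [this, mul_one]
        _ = _ := by ring
    · congr 2
      · refine Finset.sum_congr rfl fun i _ => ?_
        rw [ENNReal.mul_rpow_of_nonneg _ _ hp0.le, ← ENNReal.rpow_mul,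
          one_div_mul_cancel hp0.ne', ENNReal.rpow_one]
      · refine Finset.sum_congr rfl fun i _ => ?_
        rw [ENNReal.mul_rpow_of_nonneg _ _ hp'0.le, ENNReal.mul_rpow_of_nonneg _ _ hp'0.le,
          ← ENNReal.rpow_mul, ← ENNReal.rpow_mul]
        have : -(1 / p) * p' = 1 - p' := by
          have : p - 1 ≠ 0 := by linarith
          rw [hp'v]; field_simp; ring
        rw [this, hc]
        ring
  set N := (∑ i ∈ s, G i ^ p * w i) ^ (1 / p) with hN
  have hmain : A ≤ ENNReal.ofReal q * (ENNReal.ofReal σ * C) ^ (1 / p') * N * A ^ (1 / q') := by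
    have e : (A ^ (p' / q' - 1) * A) ^ (1 / p') = A ^ (1 / q') := by
      conv_lhs => rw [← ENNReal.rpow_one A, ← ENNReal.rpow_mul, one_mul,
        ← ENNReal.rpow_add_of_nonneg _ _ hθ zero_le_one, ← ENNReal.rpow_mul]
      congr 1
      field_simp; ring
    calc A ≤ ENNReal.ofReal q * B := hAB
      _ ≤ ENNReal.ofReal q * (N * (ENNReal.ofReal σ * C * (A ^ (p' / q' - 1) * A)) ^ (1 / p')) := by
          gcongr
          refine hHolder.trans ?_
          gcongr
          refine hcS.trans ?_
          gcongr
      _ = _ := by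
          rw [ENNReal.mul_rpow_of_nonneg _ _ (by positivity), e]
          ring
  rcases eq_or_ne A 0 with h0 | h0
  · rw [h0, ENNReal.zero_rpow_of_pos (by positivity)]
    exact zero_le
  have h1 : A ^ (1 / q') ≠ 0 := by simp [h0, hAtop, ENNReal.rpow_eq_zero_iff]
  have h2 : A ^ (1 / q') ≠ ∞ := ENNReal.rpow_ne_top_of_nonneg (by positivity) hAtop
  have h3 : A = A ^ (1 / q) * A ^ (1 / q') := by
    rw [← ENNReal.rpow_add _ _ h0 hAtop, one_div, one_div, hqconj.inv_add_inv_eq_one,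
      ENNReal.rpow_one]
  exact (ENNReal.mul_le_mul_iff_left h1 h2).1 (h3 ▸ hmain)

end Tree

section Embedding

open Metric Filter Topology

/-! ### Geometry of the dyadic boxes. -/

/-- The dyadic Carleson box over the dyadic interval `[j 2^k, (j + 1) 2^k)`, for `i = (k, j)`. -/
def dyadicBox (i : ℤ × ℤ) : Set ℂ :=
  {z | 0 ≤ z.re ∧ z.re < 2 ^ i.1 ∧ ⌊z.im / 2 ^ i.1⌋ = i.2}

/-- A point in the top half of a dyadic box. -/
noncomputable def dyadicCenter (i : ℤ × ℤ) : ℂ := ⟨7 / 8 * 2 ^ i.1, (i.2 + 1 / 2) * 2 ^ i.1⟩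

/-- A neighbourhood of the top half of a dyadic box. -/
def dyadicNhd (i : ℤ × ℤ) : Set ℂ :=
  {z | 1 / 4 * 2 ^ i.1 < z.re ∧ z.re < 2 * 2 ^ i.1 ∧ |z.im - (i.2 + 1 / 2) * 2 ^ i.1| ≤ 2 ^ i.1}

theorem measurableSet_dyadicBox (i : ℤ × ℤ) : MeasurableSet (dyadicBox i) := by
  have h : Measurable fun z : ℂ => ⌊z.im / 2 ^ i.1⌋ := (Complex.measurable_im.div_const _).floor
  exact (measurableSet_le measurable_const Complex.measurable_re).inter
    ((measurableSet_lt Complex.measurable_re measurable_const).inter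
      (h (measurableSet_singleton i.2)))

theorem measurableSet_dyadicNhd (i : ℤ × ℤ) : MeasurableSet (dyadicNhd i) :=
  (measurableSet_lt measurable_const Complex.measurable_re).inter
    ((measurableSet_lt Complex.measurable_re measurable_const).inter
      (measurableSet_le (Complex.measurable_im.sub_const _).norm measurable_const))

theorem measurableSet_carlesonSquare (a : ℂ) : MeasurableSet (carlesonSquare a) :=
  (measurableSet_le measurable_const Complex.measurable_re).inter
    ((measurableSet_lt Complex.measurable_re measurable_const).inter
      (measurableSet_le (Complex.measurable_im.sub_const _).norm measurable_const))

theorem mem_dyadicBox_iff {i : ℤ × ℤ} {z : ℂ} : z ∈ dyadicBox i ↔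
    0 ≤ z.re ∧ z.re < 2 ^ i.1 ∧ i.2 * 2 ^ i.1 ≤ z.im ∧ z.im < (i.2 + 1) * 2 ^ i.1 := by
  have h : (0 : ℝ) < 2 ^ i.1 := by positivity
  rw [dyadicBox, mem_ofPred_eq, Int.floor_eq_iff, le_div_iff₀ h, div_lt_iff₀ h]

/-- The index at a coarse scale is determined by the index at a finer one; this is what makes the
boxes laminar. -/
theorem floor_div_two_zpow {k l : ℤ} (h : k ≤ l) (y : ℝ) :
    ⌊y / 2 ^ l⌋ = ⌊y / 2 ^ k⌋ / 2 ^ (l - k).toNat := by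
  have := Int.floor_div_natCast (y / 2 ^ k) (2 ^ (l - k).toNat)
  push_cast at this
  rw [← this, div_div]
  congr 2
  rw [← zpow_natCast, ← zpow_add₀ two_ne_zero, Int.toNat_of_nonneg (by lia)]
  congr 1
  lia

theorem dyadicBox_subset {i j : ℤ × ℤ} {x : ℂ} (hi : x ∈ dyadicBox i) (hj : x ∈ dyadicBox j)
    (h : i.1 ≤ j.1) : dyadicBox i ⊆ dyadicBox j := by
  intro z hz
  refine ⟨hz.1, hz.2.1.trans_le (zpow_le_zpow_right₀ one_le_two h), ?_⟩
  rw [floor_div_two_zpow h, hz.2.2, ← hj.2.2, floor_div_two_zpow h x.im, hi.2.2]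

theorem dyadicCenter_mem (i : ℤ × ℤ) : dyadicCenter i ∈ rightHalfPlane := by
  simp only [rightHalfPlane, dyadicCenter, mem_ofPred_eq]
  positivity

theorem re_im_of_mem_ball {i : ℤ × ℤ} {z : ℂ} (hz : z ∈ ball (dyadicCenter i) (2 ^ i.1 / 8)) :
    3 / 4 * 2 ^ i.1 < z.re ∧ z.re < 2 ^ i.1 ∧
      |z.im - (i.2 + 1 / 2) * 2 ^ i.1| ≤ 2 ^ i.1 / 8 := by
  rw [mem_ball_iff_norm] at hz
  have h1 := (Complex.abs_re_le_norm (z - dyadicCenter i)).trans_lt hz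
  have h2 := (Complex.abs_im_le_norm (z - dyadicCenter i)).trans_lt hz
  simp only [dyadicCenter, Complex.sub_re, Complex.sub_im] at h1 h2
  rw [abs_lt] at h1
  exact ⟨by linarith, by linarith, h2.le⟩

theorem ball_subset_dyadicBox (i : ℤ × ℤ) :
    ball (dyadicCenter i) (2 ^ i.1 / 8) ⊆ dyadicBox i := by
  intro z hz
  obtain ⟨h1, h2, h3⟩ := re_im_of_mem_ball hz
  have h : (0 : ℝ) < 2 ^ i.1 := by positivity
  rw [abs_le] at h3
  exact mem_dyadicBox_iff.2 ⟨by linarith, h2, by linarith, by linarith⟩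

theorem ball_subset_dyadicNhd (i : ℤ × ℤ) :
    ball (dyadicCenter i) (2 ^ i.1 / 8) ⊆ dyadicNhd i := by
  intro z hz
  obtain ⟨h1, h2, h3⟩ := re_im_of_mem_ball hz
  have h : (0 : ℝ) < 2 ^ i.1 := by positivity
  exact ⟨by linarith, by linarith, by linarith⟩

theorem dyadicNhd_subset (i : ℤ × ℤ) : dyadicNhd i ⊆ rightHalfPlane := fun z hz => by
  have h : (0 : ℝ) < 2 ^ i.1 := by positivity
  have := hz.1
  simp only [rightHalfPlane, mem_ofPred_eq]
  linarith

/-- In units of 2^k, z is within 1/8 of the box's midline and the box has half-height 1/2, while Re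
z > 3/4 > 5/8. For z in the whole top half this could fail, hence the small balls. -/
theorem dyadicBox_subset_carlesonSquare {i : ℤ × ℤ} {z : ℂ}
    (hz : z ∈ ball (dyadicCenter i) (2 ^ i.1 / 8)) : dyadicBox i ⊆ carlesonSquare z := by
  intro u hu
  obtain ⟨h1, h2, h3⟩ := re_im_of_mem_ball hz
  obtain ⟨u1, u2, u3, u4⟩ := mem_dyadicBox_iff.1 hu
  rw [abs_le] at h3
  refine ⟨u1, by linarith, ?_⟩
  rw [abs_le]
  constructor <;> linarith

/-- The real part determines the scale, and boxes of one scale are disjoint. Disjointness lets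
integrals over the balls be added in the testing condition. -/
theorem pairwise_disjoint_ball_dyadicCenter :
    Pairwise (Function.onFun Disjoint
      fun i : ℤ × ℤ => ball (dyadicCenter i) ((2 : ℝ) ^ i.1 / 8)) := by
  have key : ∀ (i j : ℤ × ℤ) (z : ℂ), z ∈ ball (dyadicCenter i) (2 ^ i.1 / 8) →
      z ∈ ball (dyadicCenter j) (2 ^ j.1 / 8) → i.1 ≤ j.1 := by
    intro i j z hi hj
    obtain ⟨h1, h2, -⟩ := re_im_of_mem_ball hi
    obtain ⟨h1', h2', -⟩ := re_im_of_mem_ball hj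
    have h : (0 : ℝ) < 2 ^ i.1 := by positivity
    have : (2 : ℝ) ^ i.1 < 2 ^ (j.1 + 1) := by
      rw [zpow_add_one₀ two_ne_zero]; linarith
    have := (zpow_lt_zpow_iff_right₀ one_lt_two).1 this
    lia
  intro i j hij
  rw [Function.onFun, Set.disjoint_left]
  intro z hi hj
  have h1 : i.1 = j.1 := le_antisymm (key i j z hi hj) (key j i z hj hi)
  refine hij (Prod.ext h1 ?_)
  rw [← (ball_subset_dyadicBox i hi).2.2, ← (ball_subset_dyadicBox j hj).2.2, h1]

theorem halfPlaneDist_comm (z w : ℂ) : halfPlaneDist z w = halfPlaneDist w z := by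
  rw [halfPlaneDist, halfPlaneDist, norm_sub_rev, mul_comm z.re]

/-- The constant is 6 = 3 / (2 · 1/4): the distance is at most 3 · 2^k and the geometric mean of the
real parts at least 2^k / 4. -/
theorem halfPlaneDist_dyadicCenter_le {i : ℤ × ℤ} {z : ℂ} (hz : z ∈ dyadicNhd i) :
    halfPlaneDist z (dyadicCenter i) ≤ 2 * Real.arsinh 6 := by
  have h : (0 : ℝ) < 2 ^ i.1 := by positivity
  obtain ⟨h1, h2, h3⟩ := hz
  rw [halfPlaneDist]
  refine mul_le_mul_of_nonneg_left (Real.arsinh_le_arsinh.2 ?_) zero_le_two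
  have hn : ‖z - dyadicCenter i‖ ≤ 3 * 2 ^ i.1 := by
    refine (Complex.norm_le_abs_re_add_abs_im _).trans ?_
    have : |(z - dyadicCenter i).re| ≤ 2 * 2 ^ i.1 := by
      simp only [dyadicCenter, Complex.sub_re, abs_le]
      constructor <;> linarith
    have h4 : |(z - dyadicCenter i).im| ≤ 2 ^ i.1 := h3
    linarith
  have hs : 1 / 4 * 2 ^ i.1 ≤ Real.sqrt (z.re * (dyadicCenter i).re) := by
    refine Real.le_sqrt_of_sq_le ?_
    rw [dyadicCenter]
    simp only
    nlinarith
  rw [div_le_iff₀ (by linarith)]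
  linarith

/-- A regular weight is comparable to a constant on each dyadic region. -/
theorem IsRegularWeight.exists_comparable_dyadic {ρ : ℂ → ℝ} (hρ : IsRegularWeight ρ) :
    ∃ δ : ℝ, 0 < δ ∧ ∀ i, ∀ z ∈ dyadicNhd i,
      ρ z ≤ δ * ρ (dyadicCenter i) ∧ ρ (dyadicCenter i) ≤ δ * ρ z := by
  have h6 : 0 < Real.arsinh 6 := Real.arsinh_pos_iff.2 (by norm_num)
  obtain ⟨δ, hδ, h⟩ := hρ.comparable (2 * Real.arsinh 6) (by linarith)
  refine ⟨δ, hδ, fun i z hz => ⟨h _ (dyadicNhd_subset i hz) _ (dyadicCenter_mem i)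
    (halfPlaneDist_dyadicCenter_le hz), h _ (dyadicCenter_mem i) _ (dyadicNhd_subset i hz) ?_⟩⟩
  rw [halfPlaneDist_comm]
  exact halfPlaneDist_dyadicCenter_le hz

/-! ### Passing the testing condition from Carleson squares to boxes. -/

/-- The Carleson square with the lower corner of a dyadic box and side `t`. -/
noncomputable def cornerCenter (i : ℤ × ℤ) (t : ℝ) : ℂ := ⟨t / 2, i.2 * 2 ^ i.1 + t / 2⟩

theorem mem_carlesonSquare_cornerCenter {i : ℤ × ℤ} {t : ℝ} {z : ℂ} :
    z ∈ carlesonSquare (cornerCenter i t) ↔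
      0 ≤ z.re ∧ z.re < t ∧ i.2 * 2 ^ i.1 ≤ z.im ∧ z.im ≤ i.2 * 2 ^ i.1 + t := by
  simp only [carlesonSquare, cornerCenter, mem_ofPred_eq, abs_le]
  constructor
  · rintro ⟨h1, h2, h3, h4⟩
    exact ⟨h1, by linarith, by linarith, by linarith⟩
  · rintro ⟨h1, h2, h3, h4⟩
    exact ⟨h1, by linarith, by linarith, by linarith⟩

/-- Since μ need not be doubling, the box cannot be replaced by a larger square on the right of the
testing condition. It is exhausted from inside instead: closed sides of length t ↑ 2^k fill a
half-open one. -/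
theorem exists_monotone_carlesonSquare_iUnion_eq_dyadicBox (i : ℤ × ℤ) :
    ∃ a : ℕ → ℂ, (∀ n, a n ∈ rightHalfPlane) ∧ Monotone (fun n => carlesonSquare (a n)) ∧
      ⋃ n, carlesonSquare (a n) = dyadicBox i := by
  have h : (0 : ℝ) < 2 ^ i.1 := by positivity
  obtain ⟨t, ht, htlt, htlim⟩ := exists_seq_strictMono_tendsto' h
  refine ⟨fun n => cornerCenter i (t n), fun n => ?_, fun n m hnm z hz => ?_, ?_⟩
  · have := (htlt n).1
    simp only [rightHalfPlane, cornerCenter, mem_ofPred_eq]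
    linarith
  · simp only [mem_carlesonSquare_cornerCenter] at hz ⊢
    have := ht.monotone hnm
    exact ⟨hz.1, by linarith, hz.2.2.1, by linarith⟩
  · ext z
    simp only [mem_iUnion, mem_carlesonSquare_cornerCenter, mem_dyadicBox_iff]
    constructor
    · rintro ⟨n, h1, h2, h3, h4⟩
      have := (htlt n).2
      exact ⟨h1, by linarith, h3, by linarith⟩
    · rintro ⟨h1, h2, h3, h4⟩
      obtain ⟨n, hn⟩ := (htlim.eventually (lt_mem_nhds (max_lt h2
        (by linarith : z.im - i.2 * 2 ^ i.1 < 2 ^ i.1)))).exists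
      rw [max_lt_iff] at hn
      exact ⟨n, h1, hn.1, h3, by linarith⟩

theorem dyadicBox_nonempty (i : ℤ × ℤ) : (dyadicBox i).Nonempty :=
  ⟨_, ball_subset_dyadicBox i (mem_ball_self (by positivity))⟩

theorem measure_dyadicBox_lt_top {μ : Measure ℂ}
    (hμfin : ∀ a ∈ rightHalfPlane, μ (carlesonSquare a) < ∞) (i : ℤ × ℤ) :
    μ (dyadicBox i) < ∞ :=
  (measure_mono (dyadicBox_subset_carlesonSquare (mem_ball_self (by positivity)))).trans_lt
    (hμfin _ (dyadicCenter_mem i))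

/-- The testing condition on Carleson squares implies the testing condition on dyadic boxes. -/
theorem exists_dyadic_testing {p q : ℝ} (hp : 1 < p) (hq : 1 < q) {μ : Measure ℂ}
    (hμfin : ∀ a ∈ rightHalfPlane, μ (carlesonSquare a) < ∞)
    {ρ : ℂ → ℝ} (hρ : IsRegularWeight ρ)
    (hTree : ∃ C : ℝ≥0, ∀ a ∈ rightHalfPlane,
      (∫⁻ z in carlesonSquare a,
          μ (carlesonSquare a ∩ carlesonSquare z) ^ p.conjExponent
            * ENNReal.ofReal (ρ z ^ (1 - p.conjExponent) / z.re ^ 2))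
        ^ (q.conjExponent / p.conjExponent) ≤ C * μ (carlesonSquare a)) :
    ∃ C : ℝ≥0, ∀ (s : Finset (ℤ × ℤ)) (i : ℤ × ℤ), (∀ j ∈ s, dyadicBox j ⊆ dyadicBox i) →
      ∑ j ∈ s, μ (dyadicBox j) ^ p.conjExponent *
          ENNReal.ofReal (ρ (dyadicCenter j)) ^ (1 - p.conjExponent)
        ≤ C * μ (dyadicBox i) ^ (p.conjExponent / q.conjExponent) := by
  obtain ⟨C, hC⟩ := hTree
  obtain ⟨δ, hδ, hcomp⟩ := hρ.exists_comparable_dyadic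
  have hp'1 : 1 < p.conjExponent := (Real.HolderConjugate.conjExponent hp).symm.lt
  have hq'1 : 1 < q.conjExponent := (Real.HolderConjugate.conjExponent hq).symm.lt
  set p' := p.conjExponent
  set q' := q.conjExponent
  have hpq' : 0 < p' / q' := by positivity
  -- As 1 - p' < 0, an upper bound for ρ z yields a lower bound for the integrand.
  have hlow : ∀ j, ∀ z ∈ ball (dyadicCenter j) (2 ^ j.1 / 8),
      ENNReal.ofReal ((δ * ρ (dyadicCenter j)) ^ (1 - p') / (2 ^ j.1) ^ 2)
        ≤ ENNReal.ofReal (ρ z ^ (1 - p') / z.re ^ 2) := by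
    intro j z hz
    have hzN := ball_subset_dyadicNhd j hz
    have hzpos := hρ.pos z (dyadicNhd_subset j hzN)
    have hre : 0 < z.re := dyadicNhd_subset j hzN
    refine ENNReal.ofReal_le_ofReal (div_le_div₀ (by positivity) ?_ (by positivity) ?_)
    · exact Real.rpow_le_rpow_of_nonpos hzpos (hcomp j z hzN).1 (by linarith)
    · have := (re_im_of_mem_ball hz).2.1
      gcongr
  set κ : ℤ × ℤ → ℝ≥0∞ :=
    fun j => ENNReal.ofReal ((δ * ρ (dyadicCenter j)) ^ (1 - p') / (2 ^ j.1) ^ 2) with hκ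
  -- The area π (2^k / 8)^2 cancels the factor (2^k)^2 and leaves π / 64.
  have hκvol : ∀ j, κ j * volume (ball (dyadicCenter j) (2 ^ j.1 / 8)) =
      ENNReal.ofReal (Real.pi / 64 * δ ^ (1 - p')) *
        ENNReal.ofReal (ρ (dyadicCenter j)) ^ (1 - p') := by
    intro j
    have hpos := hρ.pos _ (dyadicCenter_mem j)
    rw [Complex.volume_ball, ENNReal.ofReal_rpow_of_pos hpos, ← ENNReal.ofReal_mul (by positivity),
      ← ENNReal.ofReal_pow (by positivity), ← ENNReal.ofReal_coe_nnreal,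
      ← ENNReal.ofReal_mul (by positivity), hκ, ← ENNReal.ofReal_mul (by positivity),
      Real.mul_rpow hδ.le hpos.le, NNReal.coe_real_pi]
    congr 1
    have h : (0 : ℝ) < 2 ^ j.1 := by positivity
    field_simp
    ring
  set c := ENNReal.ofReal (Real.pi / 64 * δ ^ (1 - p')) with hc
  have hc0 : c ≠ 0 := by
    have : 0 < Real.pi / 64 * δ ^ (1 - p') := by positivity
    simpa [hc] using this
  have hctop : c ≠ ∞ := ENNReal.ofReal_ne_top
  refine ⟨(c⁻¹ * (C : ℝ≥0∞) ^ (p' / q')).toNNReal, fun s i hs => ?_⟩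
  rw [ENNReal.coe_toNNReal (ENNReal.mul_ne_top (ENNReal.inv_ne_top.2 hc0)
    (ENNReal.rpow_ne_top_of_nonneg hpq'.le ENNReal.coe_ne_top))]
  obtain ⟨a, ha, hmono, hUn⟩ := exists_monotone_carlesonSquare_iUnion_eq_dyadicBox i
  have hsub : ∀ n, carlesonSquare (a n) ⊆ dyadicBox i := fun n =>
    hUn ▸ subset_iUnion (fun n => carlesonSquare (a n)) n
  have hstep : ∀ n, ∑ j ∈ s, μ (carlesonSquare (a n) ∩ dyadicBox j) ^ p' *
      (κ j * volume (carlesonSquare (a n) ∩ ball (dyadicCenter j) (2 ^ j.1 / 8)))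
      ≤ (C * μ (dyadicBox i)) ^ (p' / q') := by
    intro n
    have h1 : ∫⁻ z in carlesonSquare (a n),
          μ (carlesonSquare (a n) ∩ carlesonSquare z) ^ p'
            * ENNReal.ofReal (ρ z ^ (1 - p') / z.re ^ 2) ≤ (C * μ (dyadicBox i)) ^ (p' / q') := by
      have := (hC (a n) (ha n)).trans
        (mul_le_mul_right (measure_mono (hsub n)) _)
      rw [← ENNReal.le_rpow_inv_iff (by positivity)] at this
      rwa [inv_div] at this
    refine le_trans ?_ h1
    have hmeas : ∀ j ∈ s, MeasurableSet
        (carlesonSquare (a n) ∩ ball (dyadicCenter j) (2 ^ j.1 / 8)) :=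
      fun j _ => (measurableSet_carlesonSquare _).inter measurableSet_ball
    refine le_trans ?_ (lintegral_mono_set (s := ⋃ j ∈ s,
      carlesonSquare (a n) ∩ ball (dyadicCenter j) (2 ^ j.1 / 8)) ?_)
    · rw [lintegral_biUnion_finset ?_ hmeas]
      · refine Finset.sum_le_sum fun j hj => ?_
        rw [← mul_assoc, ← setLIntegral_const]
        refine setLIntegral_mono' (hmeas j hj) fun z hz => ?_
        gcongr ?_ ^ _ * ?_
        · exact measure_mono (inter_subset_inter_right _ (dyadicBox_subset_carlesonSquare hz.2))
        · exact hlow j z hz.2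
      · intro j _ k _ hjk
        exact (pairwise_disjoint_ball_dyadicCenter hjk).mono inter_subset_right inter_subset_right
    · exact iUnion₂_subset fun j _ => inter_subset_left
  -- Continuity from below along the exhausting squares, used for both μ and area.
  have hlim : ∀ (m : Measure ℂ) (t : Set ℂ), t ⊆ dyadicBox i →
      Tendsto (fun n => m (carlesonSquare (a n) ∩ t)) atTop (𝓝 (m t)) := by
    intro m t ht
    have := tendsto_measure_iUnion_atTop (μ := m) (s := fun n => carlesonSquare (a n) ∩ t)
      fun n k hnk => inter_subset_inter_left _ (hmono hnk)
    rwa [← iUnion_inter, hUn, inter_eq_right.2 ht] at this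
  have hfinal : ∑ j ∈ s, μ (dyadicBox j) ^ p' *
      (κ j * volume (ball (dyadicCenter j) (2 ^ j.1 / 8)))
      ≤ (C * μ (dyadicBox i)) ^ (p' / q') := by
    refine le_of_tendsto' (x := (atTop : Filter ℕ)) (tendsto_finsetSum s fun j hj => ?_) hstep
    refine ENNReal.Tendsto.mul ((hlim μ _ (hs j hj)).ennrpow_const _) (Or.inr ?_)
      (ENNReal.Tendsto.const_mul (hlim volume _ ((ball_subset_dyadicBox j).trans (hs j hj)))
        (Or.inr ENNReal.ofReal_ne_top)) (Or.inr ?_)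
    · exact ENNReal.mul_ne_top ENNReal.ofReal_ne_top measure_ball_lt_top.ne
    · exact ENNReal.rpow_ne_top_of_nonneg (by positivity) (measure_dyadicBox_lt_top hμfin j).ne
  rw [ENNReal.mul_rpow_of_nonneg _ _ hpq'.le] at hfinal
  have : ∑ j ∈ s, μ (dyadicBox j) ^ p' *
      (κ j * volume (ball (dyadicCenter j) (2 ^ j.1 / 8))) =
      c * ∑ j ∈ s, μ (dyadicBox j) ^ p' * ENNReal.ofReal (ρ (dyadicCenter j)) ^ (1 - p') := by
    rw [Finset.mul_sum]
    refine Finset.sum_congr rfl fun j _ => ?_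
    rw [hκvol]
    ring
  rw [this] at hfinal
  calc _ = c⁻¹ * (c * ∑ j ∈ s, μ (dyadicBox j) ^ p' *
        ENNReal.ofReal (ρ (dyadicCenter j)) ^ (1 - p')) := by
        rw [← mul_assoc, ENNReal.inv_mul_cancel hc0 hctop, one_mul]
    _ ≤ c⁻¹ * (C ^ (p' / q') * μ (dyadicBox i) ^ (p' / q')) := by gcongr
    _ = _ := by rw [mul_assoc]

/-! ### Bounded overlap of the dyadic neighbourhoods. -/

open Classical in
theorem card_filter_mem_dyadicNhd_le (s : Finset (ℤ × ℤ)) (z : ℂ) :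
    (s.filter (fun i => z ∈ dyadicNhd i)).card ≤ 16 := by
  by_cases hz : 0 < z.re
  swap
  · rw [Finset.card_eq_zero.2]
    · norm_num
    · rw [Finset.filter_eq_empty_iff]
      exact fun i _ hi => hz (dyadicNhd_subset i hi)
  obtain ⟨n, hn1, hn2⟩ := exists_mem_Ico_zpow hz one_lt_two
  -- Re z confines k to four scales, and Im z confines j to four indices at each: 16 in all, not
  -- meant to be sharp.
  have : s.filter (fun i => z ∈ dyadicNhd i) ⊆ (Finset.Icc (n - 1) (n + 2)).biUnion
      fun k => (Finset.Icc (⌊z.im / 2 ^ k⌋ - 2) (⌊z.im / 2 ^ k⌋ + 1)).image fun j => (k, j) := by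
    rintro ⟨k, j⟩ hi
    obtain ⟨h1, h2, h3⟩ := (Finset.mem_filter.1 hi).2
    simp only at h1 h2 h3
    have h : (0 : ℝ) < 2 ^ k := by positivity
    have e1 : (2 : ℝ) ^ n < 2 ^ (k + 1) := by rw [zpow_add_one₀ two_ne_zero]; linarith
    have e2 : (2 : ℝ) ^ k < 2 ^ (n + 3) := by
      have : (2 : ℝ) ^ (n + 3) = 2 ^ (n + 1) * 4 := by
        rw [show n + 3 = n + 1 + 2 by ring, zpow_add₀ two_ne_zero]; norm_num
      linarith
    rw [zpow_lt_zpow_iff_right₀ one_lt_two] at e1 e2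
    have e3 : |z.im / 2 ^ k - (j + 1 / 2)| ≤ 1 := by
      rw [div_sub' h.ne', abs_div, abs_of_pos h, div_le_one h, mul_comm]
      exact h3
    rw [abs_le] at e3
    have f1 := Int.floor_le (z.im / 2 ^ k)
    have f2 := Int.lt_floor_add_one (z.im / 2 ^ k)
    simp only [Finset.mem_biUnion, Finset.mem_image, Finset.mem_Icc]
    refine ⟨k, ⟨by lia, by lia⟩, j, ⟨?_, ?_⟩, rfl⟩
    · have : ((⌊z.im / 2 ^ k⌋ : ℤ) : ℝ) < (j + 2 : ℤ) := by push_cast; linarith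
      have := Int.cast_lt.1 this
      lia
    · have : ((j : ℤ) : ℝ) < (⌊z.im / 2 ^ k⌋ + 2 : ℤ) := by push_cast; linarith
      have := Int.cast_lt.1 this
      lia
  refine (Finset.card_le_card this).trans ((Finset.card_biUnion_le_card_mul _ _ 4 ?_).trans ?_)
  · intro k _
    refine Finset.card_image_le.trans ?_
    simp only [Int.card_Icc]
    lia
  · simp only [Int.card_Icc]
    lia

theorem sum_indicator_dyadicNhd_le (s : Finset (ℤ × ℤ)) (f : ℂ → ℝ≥0∞) (z : ℂ) :
    ∑ i ∈ s, (dyadicNhd i).indicator f z ≤ 16 * f z := by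
  classical
  simp only [indicator_apply]
  rw [← Finset.sum_filter, Finset.sum_const, nsmul_eq_mul]
  gcongr
  exact_mod_cast card_filter_mem_dyadicNhd_le s z

/-! ### Sub-mean value properties. -/

theorem Complex.lintegral_eq_lintegral_polar {H : ℂ → ℝ≥0∞} (hH : Measurable H) :
    ∫⁻ z, H z = ∫⁻ t in Ioi (0 : ℝ), ∫⁻ θ in Ioo (-Real.pi) Real.pi,
      ENNReal.ofReal t * H (Complex.polarCoord.symm (t, θ)) := by
  have hm : Measurable fun p : ℝ × ℝ =>
      ENNReal.ofReal p.1 * H (Complex.polarCoord.symm p) := by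
    refine (measurable_fst.ennreal_ofReal).mul (hH.comp ?_)
    have : Continuous fun p : ℝ × ℝ =>
        (p.1 * (Real.cos p.2 + Real.sin p.2 * Complex.I) : ℂ) := by fun_prop
    have e : ⇑Complex.polarCoord.symm = fun p : ℝ × ℝ =>
        (p.1 * (Real.cos p.2 + Real.sin p.2 * Complex.I) : ℂ) :=
      funext Complex.polarCoord_symm_apply
    exact e ▸ this.measurable
  rw [← Complex.lintegral_comp_polarCoord_symm, polarCoord_target, Measure.volume_eq_prod,
    ← Measure.prod_restrict]
  exact lintegral_prod _ hm.aemeasurable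

/-- The norm of a holomorphic function satisfies the sub-mean value property on circles. -/
theorem enorm_le_lintegral_circle {g : ℂ → ℂ} {w : ℂ} {t : ℝ}
    (hg : DiffContOnCl ℂ g (ball w |t|)) :
    ENNReal.ofReal (2 * Real.pi) * ‖g w‖ₑ
      ≤ ∫⁻ θ in Ioo (-Real.pi) Real.pi, ‖g (circleMap w t θ)‖ₑ := by
  have h2π : (0 : ℝ) < 2 * Real.pi := by positivity
  have h := hg.circleAverage
  rw [Real.circleAverage_eq_integral_add (-Real.pi),
    intervalIntegral.integral_comp_add_right (fun θ => g (circleMap w t θ)),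
    inv_smul_eq_iff₀ h2π.ne', zero_add, show 2 * Real.pi + -Real.pi = Real.pi by ring,
    intervalIntegral.integral_of_le (by linarith [Real.pi_pos]), integral_Ioc_eq_integral_Ioo] at h
  have e : ENNReal.ofReal (2 * Real.pi) * ‖g w‖ₑ = ‖(2 * Real.pi) • g w‖ₑ := by
    rw [enorm_smul, Real.enorm_of_nonneg h2π.le]
  rw [e, ← h]
  exact enorm_integral_le_lintegral_enorm _

/-- The norm of a holomorphic function satisfies the sub-mean value property on discs. -/
theorem enorm_mul_volume_ball_le_lintegral {g : ℂ → ℂ} {w : ℂ} {r : ℝ}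
    (hg : DifferentiableOn ℂ g (ball w r)) :
    ‖g w‖ₑ * volume (ball w r) ≤ ∫⁻ z in ball w r, ‖g z‖ₑ := by
  classical
  have hcont : ContinuousOn (fun z => ‖g z‖ₑ) (ball w r) := hg.continuousOn.enorm
  have hm : Measurable ((ball w r).indicator fun z => ‖g z‖ₑ) := by
    have := hcont.measurable_piecewise (g := 0) continuousOn_const
      (measurableSet_ball (x := w) (ε := r))
    rwa [piecewise_eq_indicator] at this
  have hm' : Measurable ((ball w r).indicator fun _ => ‖g w‖ₑ) :=
    measurable_const.indicator measurableSet_ball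
  -- With the centre translated to 0, polar coordinates reduce the claim to single circles.
  rw [← lintegral_indicator_const measurableSet_ball, ← lintegral_indicator measurableSet_ball,
    ← lintegral_add_left_eq_self _ w,
    ← lintegral_add_left_eq_self ((ball w r).indicator fun z => ‖g z‖ₑ) w,
    Complex.lintegral_eq_lintegral_polar
      (H := fun x => (ball w r).indicator (fun z => ‖g z‖ₑ) (w + x))
      (hm.comp (measurable_const_add w)),
    Complex.lintegral_eq_lintegral_polar
      (H := fun x => (ball w r).indicator (fun _ => ‖g w‖ₑ) (w + x))
      (hm'.comp (measurable_const_add w))]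
  refine setLIntegral_mono' measurableSet_Ioi fun t (ht : 0 < t) => ?_
  rw [lintegral_const_mul' _ _ ENNReal.ofReal_ne_top,
    lintegral_const_mul' _ _ ENNReal.ofReal_ne_top]
  gcongr ENNReal.ofReal t * ?_
  have hpt : ∀ θ, w + Complex.polarCoord.symm (t, θ) = circleMap w t θ := fun θ => by
    rw [Complex.polarCoord_symm_apply, circleMap, Complex.exp_mul_I]
    simp
  simp only [hpt]
  by_cases htr : t < r
  · have hmem : ∀ θ, circleMap w t θ ∈ ball w r := fun θ => by
      rw [mem_ball_iff_norm, circleMap_sub_center, norm_circleMap_zero, abs_of_pos ht]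
      exact htr
    simp only [indicator_of_mem (hmem _)]
    refine le_trans (le_of_eq ?_) (enorm_le_lintegral_circle (t := t) ?_)
    · rw [setLIntegral_const, Real.volume_Ioo, mul_comm]
      congr 2
      ring
    · refine DifferentiableOn.diffContOnCl (hg.mono ?_)
      refine closure_ball_subset_closedBall.trans (closedBall_subset_ball ?_)
      rwa [abs_of_pos ht]
  · have hmem : ∀ θ, circleMap w t θ ∉ ball w r := fun θ => by
      rw [mem_ball_iff_norm, circleMap_sub_center, norm_circleMap_zero, abs_of_pos ht]
      exact htr
    simp only [indicator_of_notMem (hmem _), lintegral_zero, le_refl]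

/-- Sub-mean value property of `|g|^p`. -/
theorem enorm_rpow_mul_volume_ball_le_lintegral {g : ℂ → ℂ} {w : ℂ} {r p : ℝ} (hp : 1 ≤ p)
    (hr : 0 < r) (hg : DifferentiableOn ℂ g (ball w r)) :
    ‖g w‖ₑ ^ p * volume (ball w r) ≤ ∫⁻ z in ball w r, ‖g z‖ₑ ^ p := by
  have hp0 : 0 < p := by linarith
  have h1 := enorm_mul_volume_ball_le_lintegral hg
  have hV0 : volume (ball w r) ≠ 0 := (measure_ball_pos _ _ hr).ne'
  have hVtop : volume (ball w r) ≠ ∞ := measure_ball_lt_top.ne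
  have hmeas : AEStronglyMeasurable g (volume.restrict (ball w r)) :=
    hg.continuousOn.aestronglyMeasurable measurableSet_ball
  -- Hölder on the disc passes from exponent 1 to p.
  have h2 := eLpNorm_le_eLpNorm_mul_rpow_measure_univ (p := 1) (q := ENNReal.ofReal p)
    (ENNReal.one_le_ofReal.2 hp) hmeas
  rw [eLpNorm_one_eq_lintegral_enorm, eLpNorm_eq_lintegral_rpow_enorm_toReal
    (by simpa using hp0) ENNReal.ofReal_ne_top, ENNReal.toReal_ofReal hp0.le,
    Measure.restrict_apply_univ, ENNReal.toReal_one] at h2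
  set V := volume (ball w r)
  set I := ∫⁻ z in ball w r, ‖g z‖ₑ ^ p
  have h3 : (‖g w‖ₑ * V) ^ p ≤ (I ^ (1 / p) * V ^ (1 / 1 - 1 / p)) ^ p :=
    ENNReal.rpow_le_rpow (h1.trans h2) hp0.le
  rw [ENNReal.mul_rpow_of_nonneg _ _ hp0.le, ENNReal.mul_rpow_of_nonneg _ _ hp0.le,
    ← ENNReal.rpow_mul, one_div_mul_cancel hp0.ne', ENNReal.rpow_one, ← ENNReal.rpow_mul,
    show (1 / 1 - 1 / p) * p = p - 1 by field_simp] at h3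
  have h4 : V ^ p = V * V ^ (p - 1) := by
    conv_rhs => rw [← ENNReal.rpow_one V, ← ENNReal.rpow_mul, one_mul,
      ← ENNReal.rpow_add _ _ hV0 hVtop]
    congr 1
    ring
  rw [h4, ← mul_assoc] at h3
  exact (ENNReal.mul_le_mul_iff_left (by simp [hV0, hVtop, ENNReal.rpow_eq_zero_iff])
    (ENNReal.rpow_ne_top_of_nonneg (by linarith) hVtop)).1 h3

/-! ### Decay at infinity in Zen spaces. -/

theorem isOpen_rightHalfPlane : IsOpen rightHalfPlane :=
  isOpen_lt continuous_const Complex.continuous_re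

theorem measurable_indicator_enorm_rpow {F : ℂ → ℂ} {U : Set ℂ} (hU : IsOpen U)
    (hF : ContinuousOn F U) (p : ℝ) : Measurable (U.indicator fun z => ‖F z‖ₑ ^ p) := by
  classical
  have h : ContinuousOn (fun z => ‖F z‖ₑ ^ p) U :=
    (ENNReal.continuous_rpow_const (y := p)).comp_continuousOn hF.enorm
  have := h.measurable_piecewise (g := 0) continuousOn_const hU.measurableSet
  rwa [piecewise_eq_indicator] at this

theorem measurable_complex_mk : Measurable fun w : ℝ × ℝ => (⟨w.1, w.2⟩ : ℂ) :=
  Complex.measurableEquivRealProd.symm.measurable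

/-- Finiteness of the Zen norm controls the integrals over discs far from the boundary. -/
theorem lintegral_ball_mul_le_zenNormPow {p : ℝ} {ν : Measure ℝ≥0} (hν : IsDelta2Measure ν)
    {F : ℂ → ℂ} (hF : DifferentiableOn ℂ F rightHalfPlane) {X : ℝ} (hX : 4 ≤ X) (y : ℝ) :
    (∫⁻ z in ball (⟨X, y⟩ : ℂ) (X / 2), ‖F z‖ₑ ^ p) * ν (Iio 1)
      ≤ zenNormPow p ν F * ENNReal.ofReal (2 * X) := by
  have := hν.regular
  set Φ : ℂ → ℝ≥0∞ := rightHalfPlane.indicator fun z => ‖F z‖ₑ ^ p with hΦ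
  have hΦm : Measurable Φ := measurable_indicator_enorm_rpow isOpen_rightHalfPlane hF.continuousOn p
  set φ : ℝ → ℝ≥0∞ := fun u => ∫⁻ t : ℝ, Φ ⟨u, t⟩ with hφ
  have hφm : Measurable φ :=
    Measurable.lintegral_prod_right' (f := fun w : ℝ × ℝ => Φ ⟨w.1, w.2⟩)
      (hΦm.comp measurable_complex_mk)
  have hline : ∀ ε : ℝ, 0 < ε → ∫⁻ x : ℝ≥0, φ (x + ε) ∂ν ≤ zenNormPow p ν F := by
    intro ε hε
    refine le_trans (le_of_eq ?_) (le_iSup₂ (f := fun (ε : ℝ) (_ : 0 < ε) =>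
      ∫⁻ w : ℝ≥0 × ℝ, ‖F ((⟨(w.1 : ℝ), w.2⟩ : ℂ) + (ε : ℂ))‖ₑ ^ p ∂(ν.prod volume)) ε hε)
    have hshift : ∀ w : ℝ≥0 × ℝ, ‖F ((⟨(w.1 : ℝ), w.2⟩ : ℂ) + (ε : ℂ))‖ₑ ^ p
        = Φ ⟨w.1 + ε, w.2⟩ := by
      intro w
      have e : (⟨(w.1 : ℝ), w.2⟩ : ℂ) + (ε : ℂ) = ⟨w.1 + ε, w.2⟩ := by
        apply Complex.ext <;> simp
      have hmem : (⟨w.1 + ε, w.2⟩ : ℂ) ∈ rightHalfPlane := by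
        have : (0 : ℝ) ≤ w.1 := w.1.2
        simp only [rightHalfPlane, mem_ofPred_eq]
        linarith
      rw [e, hΦ, indicator_of_mem hmem]
    simp only [hshift]
    have hm : Measurable fun w : ℝ≥0 × ℝ => ((w.1 : ℝ) + ε, w.2) :=
      (measurable_fst.coe_nnreal_real.add_const ε).prodMk measurable_snd
    rw [lintegral_prod]
    exact (hΦm.comp (measurable_complex_mk.comp hm)).aemeasurable
  -- Averaging the norm bound over ε turns line integrals into area integrals. The interval lies in
  -- ε > 0 and has length X + 1 ≤ 2X.
  have hswap : ∫⁻ ε in Ioo (X / 2 - 1) (3 * X / 2), ∫⁻ x : ℝ≥0, φ (x + ε) ∂ν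
      = ∫⁻ x : ℝ≥0, (∫⁻ ε in Ioo (X / 2 - 1) (3 * X / 2), φ (x + ε)) ∂ν := by
    refine lintegral_lintegral_swap (f := fun (ε : ℝ) (x : ℝ≥0) => φ (x + ε)) ?_
    exact (hφm.comp ((measurable_snd.coe_nnreal_real).add measurable_fst)).aemeasurable
  have hupper : ∫⁻ ε in Ioo (X / 2 - 1) (3 * X / 2), ∫⁻ x : ℝ≥0, φ (x + ε) ∂ν
      ≤ zenNormPow p ν F * ENNReal.ofReal (2 * X) := by
    calc _ ≤ ∫⁻ _ in Ioo (X / 2 - 1) (3 * X / 2), zenNormPow p ν F :=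
          setLIntegral_mono' measurableSet_Ioo fun ε hε => hline ε (by linarith [hε.1])
      _ ≤ _ := by
          rw [setLIntegral_const, Real.volume_Ioo]
          gcongr
          linarith
  have hball : ∫⁻ z in ball (⟨X, y⟩ : ℂ) (X / 2), ‖F z‖ₑ ^ p
      ≤ ∫⁻ u in Ioo (X / 2) (3 * X / 2), φ u := by
    have hre : ∀ z ∈ ball (⟨X, y⟩ : ℂ) (X / 2), z.re ∈ Ioo (X / 2) (3 * X / 2) := by
      intro z hz
      rw [mem_ball_iff_norm] at hz
      have h1 := (Complex.abs_re_le_norm (z - ⟨X, y⟩)).trans_lt hz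
      simp only [Complex.sub_re, abs_lt] at h1
      exact ⟨by linarith, by linarith⟩
    set Ψ : ℂ → ℝ≥0∞ := (Complex.re ⁻¹' Ioo (X / 2) (3 * X / 2)).indicator Φ with hΨ
    have hΨm : Measurable Ψ := hΦm.indicator (Complex.measurable_re measurableSet_Ioo)
    calc ∫⁻ z in ball (⟨X, y⟩ : ℂ) (X / 2), ‖F z‖ₑ ^ p
        ≤ ∫⁻ z in ball (⟨X, y⟩ : ℂ) (X / 2), Ψ z := by
          refine setLIntegral_mono' measurableSet_ball fun z hz => ?_
          have hmem : z ∈ rightHalfPlane := by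
            have := (hre z hz).1
            simp only [rightHalfPlane, mem_ofPred_eq]
            linarith
          rw [hΨ, indicator_of_mem (s := Complex.re ⁻¹' _) (hre z hz), hΦ, indicator_of_mem hmem]
      _ ≤ ∫⁻ z, Ψ z := setLIntegral_le_lintegral _ _
      _ = ∫⁻ u : ℝ, ∫⁻ t : ℝ, Ψ ⟨u, t⟩ := by
          rw [← Complex.volume_preserving_equiv_real_prod.symm.lintegral_comp hΨm,
            Measure.volume_eq_prod]
          exact lintegral_prod _ (hΨm.comp measurable_complex_mk).aemeasurable
      _ = _ := by
          rw [← lintegral_indicator measurableSet_Ioo]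
          refine lintegral_congr fun u => ?_
          by_cases hu : u ∈ Ioo (X / 2) (3 * X / 2)
          · rw [indicator_of_mem hu]
            refine lintegral_congr fun t => ?_
            rw [hΨ, indicator_of_mem]
            exact hu
          · rw [indicator_of_notMem hu]
            refine (lintegral_congr fun t => ?_).trans lintegral_zero
            rw [hΨ, indicator_of_notMem]
            exact hu
  -- A shift by x < 1 stays within the extra unit of the ε-interval.
  have hinner : ∀ x ∈ Iio (1 : ℝ≥0), ∫⁻ u in Ioo (X / 2) (3 * X / 2), φ u
      ≤ ∫⁻ ε in Ioo (X / 2 - 1) (3 * X / 2), φ (x + ε) := by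
    intro x hx
    have hx0 : (0 : ℝ) ≤ x := x.2
    have hx1 : (x : ℝ) < 1 := by exact_mod_cast hx
    rw [← lintegral_indicator measurableSet_Ioo, ← lintegral_indicator measurableSet_Ioo,
      ← lintegral_add_left_eq_self _ (x : ℝ)]
    refine lintegral_mono fun ε => ?_
    by_cases hε : (x : ℝ) + ε ∈ Ioo (X / 2) (3 * X / 2)
    · have : ε ∈ Ioo (X / 2 - 1) (3 * X / 2) := ⟨by linarith [hε.1], by linarith [hε.2]⟩
      rw [indicator_of_mem hε, indicator_of_mem this]
    · rw [indicator_of_notMem hε]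
      exact zero_le
  calc (∫⁻ z in ball (⟨X, y⟩ : ℂ) (X / 2), ‖F z‖ₑ ^ p) * ν (Iio 1)
      ≤ (∫⁻ u in Ioo (X / 2) (3 * X / 2), φ u) * ν (Iio 1) := by gcongr
    _ = ∫⁻ _ in Iio (1 : ℝ≥0), (∫⁻ u in Ioo (X / 2) (3 * X / 2), φ u) ∂ν := by
        rw [setLIntegral_const]
    _ ≤ ∫⁻ x in Iio (1 : ℝ≥0), (∫⁻ ε in Ioo (X / 2 - 1) (3 * X / 2), φ (x + ε)) ∂ν :=
        setLIntegral_mono' measurableSet_Iio hinner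
    _ ≤ _ := (setLIntegral_le_lintegral _ _).trans (hswap ▸ hupper)

/-- Functions of a Zen space tend to zero along horizontal lines. -/
theorem tendsto_zero_of_zenNormPow_lt_top {p : ℝ} (hp : 1 ≤ p) {ν : Measure ℝ≥0}
    (hν : IsDelta2Measure ν) {F : ℂ → ℂ} (hF : DifferentiableOn ℂ F rightHalfPlane)
    (hfin : zenNormPow p ν F < ∞) (y : ℝ) :
    Tendsto (fun X : ℝ => ‖F ⟨X, y⟩‖ₑ) atTop (𝓝 0) := by
  have hp0 : 0 < p := by linarith
  have hν0 : ν (Iio 1) ≠ 0 := hν.ne_zero 1 one_pos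
  set N := zenNormPow p ν F
  have hbound : ∀ X : ℝ, 4 ≤ X →
      ‖F ⟨X, y⟩‖ₑ ≤ (N / ν (Iio 1) * ENNReal.ofReal (8 / Real.pi * X⁻¹)) ^ (1 / p) := by
    intro X hX
    have hX0 : 0 < X := by linarith
    have hsub : ball (⟨X, y⟩ : ℂ) (X / 2) ⊆ rightHalfPlane := by
      intro z hz
      rw [mem_ball_iff_norm] at hz
      have h1 := (Complex.abs_re_le_norm (z - ⟨X, y⟩)).trans_lt hz
      simp only [Complex.sub_re, abs_lt] at h1
      simp only [rightHalfPlane, mem_ofPred_eq]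
      linarith
    have h1 := enorm_rpow_mul_volume_ball_le_lintegral hp (half_pos hX0) (hF.mono hsub)
    have h2 := (mul_le_mul_left h1 (ν (Iio 1))).trans
      (lintegral_ball_mul_le_zenNormPow (p := p) hν hF hX y)
    rw [← ENNReal.le_div_iff_mul_le (Or.inl hν0) (Or.inr
      (ENNReal.mul_ne_top hfin.ne ENNReal.ofReal_ne_top)), Complex.volume_ball,
      ← ENNReal.ofReal_pow (by positivity), ← ENNReal.ofReal_coe_nnreal, NNReal.coe_real_pi,
      ← ENNReal.ofReal_mul (by positivity),
      ← ENNReal.le_div_iff_mul_le (Or.inl (by simpa using by positivity))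
        (Or.inl ENNReal.ofReal_ne_top)] at h2
    rw [one_div, ENNReal.le_rpow_inv_iff hp0]
    refine h2.trans (le_of_eq ?_)
    have e : 8 / Real.pi * X⁻¹ = 2 * X / ((X / 2) ^ 2 * Real.pi) := by
      field_simp
      norm_num
    rw [e, ENNReal.ofReal_div_of_pos (by positivity)]
    simp only [div_eq_mul_inv]
    ring
  refine tendsto_of_tendsto_of_tendsto_of_le_of_le' tendsto_const_nhds ?_
    (Eventually.of_forall fun _ => zero_le) ((eventually_ge_atTop 4).mono hbound)
  have h1 : Tendsto (fun X : ℝ => 8 / Real.pi * X⁻¹) atTop (𝓝 0) := by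
    simpa using tendsto_inv_atTop_zero.const_mul (8 / Real.pi)
  have h2 := ENNReal.Tendsto.const_mul (ENNReal.tendsto_ofReal h1)
    (Or.inr (ENNReal.div_ne_top hfin.ne hν0))
  have h3 := h2.ennrpow_const (1 / p)
  simpa [hp0] using h3

/-! ### Dyadic domination of F. -/

/-- The coefficient of `F` on a dyadic box: the side length of the box times
the `L^p` mean of `F'` near its top half. -/
noncomputable def dyadicCoeff (p : ℝ) (F : ℂ → ℂ) (i : ℤ × ℤ) : ℝ≥0∞ :=
  ENNReal.ofReal (2 ^ i.1) * ((∫⁻ z in dyadicNhd i, ‖deriv F z‖ₑ ^ p) /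
    ENNReal.ofReal ((2 ^ i.1 / 4) ^ 2 * Real.pi)) ^ (1 / p)

theorem differentiableOn_deriv_rightHalfPlane {F : ℂ → ℂ}
    (hF : DifferentiableOn ℂ F rightHalfPlane) : DifferentiableOn ℂ (deriv F) rightHalfPlane :=
  hF.deriv isOpen_rightHalfPlane

/-- The disc of radius 2^k / 4 about w lies in the dyadic neighbourhood, so the sub-mean value
property of |F'|^p applies; its area is the normalisation in `dyadicCoeff`. -/
theorem ofReal_mul_enorm_deriv_le_dyadicCoeff {p : ℝ} (hp : 1 ≤ p) {F : ℂ → ℂ}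
    (hF : DifferentiableOn ℂ F rightHalfPlane) {k : ℤ} {w : ℂ} (h1 : 2 ^ k / 2 ≤ w.re)
    (h2 : w.re ≤ 2 ^ k) :
    ENNReal.ofReal (2 ^ k) * ‖deriv F w‖ₑ ≤ dyadicCoeff p F (k, ⌊w.im / 2 ^ k⌋) := by
  have hp0 : 0 < p := by linarith
  have h : (0 : ℝ) < 2 ^ k := by positivity
  have hsub : ball w (2 ^ k / 4) ⊆ dyadicNhd (k, ⌊w.im / 2 ^ k⌋) := by
    intro z hz
    rw [mem_ball_iff_norm] at hz
    have e1 := (Complex.abs_re_le_norm (z - w)).trans_lt hz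
    have e2 := (Complex.abs_im_le_norm (z - w)).trans_lt hz
    simp only [Complex.sub_re, Complex.sub_im, abs_lt] at e1 e2
    have f1 := Int.floor_le (w.im / 2 ^ k)
    have f2 := Int.lt_floor_add_one (w.im / 2 ^ k)
    rw [le_div_iff₀ h] at f1
    rw [div_lt_iff₀ h] at f2
    simp only [dyadicNhd, mem_ofPred_eq, abs_le]
    exact ⟨by linarith, by linarith, by linarith, by linarith⟩
  have hd := (differentiableOn_deriv_rightHalfPlane hF).mono (hsub.trans (dyadicNhd_subset _))
  have hv := (enorm_rpow_mul_volume_ball_le_lintegral hp (by positivity) hd).trans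
    (lintegral_mono_set hsub)
  rw [Complex.volume_ball, ← ENNReal.ofReal_pow (by positivity), ← ENNReal.ofReal_coe_nnreal,
    NNReal.coe_real_pi, ← ENNReal.ofReal_mul (by positivity),
    ← ENNReal.le_div_iff_mul_le (Or.inl (by simpa using by positivity))
      (Or.inl ENNReal.ofReal_ne_top)] at hv
  rw [dyadicCoeff]
  gcongr
  rwa [one_div, ENNReal.le_rpow_inv_iff hp0]

/-- One telescoping step: the mean value inequality on a horizontal segment inside the top half of
one box. -/
theorem enorm_le_dyadicCoeff_add {p : ℝ} (hp : 1 ≤ p) {F : ℂ → ℂ}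
    (hF : DifferentiableOn ℂ F rightHalfPlane) {k : ℤ} {y a b : ℝ}
    (ha : a ∈ Icc ((2 : ℝ) ^ k / 2) (2 ^ k)) (hb : b ∈ Icc ((2 : ℝ) ^ k / 2) (2 ^ k)) :
    ‖F ⟨a, y⟩‖ₑ ≤ dyadicCoeff p F (k, ⌊y / 2 ^ k⌋) + ‖F ⟨b, y⟩‖ₑ := by
  have h : (0 : ℝ) < 2 ^ k := by positivity
  set g := dyadicCoeff p F (k, ⌊y / 2 ^ k⌋) with hg
  rcases eq_or_ne g ∞ with hgt | hgt
  · rw [hgt, top_add]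
    exact le_top
  set s : Set ℂ := {w | w.re ∈ Icc ((2 : ℝ) ^ k / 2) (2 ^ k) ∧ w.im = y} with hs
  have hconv : Convex ℝ s := by
    have e : s = Complex.reLm ⁻¹' Icc ((2 : ℝ) ^ k / 2) (2 ^ k) ∩ Complex.imLm ⁻¹' {y} := by
      ext w; simp [hs]
    rw [e]
    exact ((convex_Icc _ _).linear_preimage _).inter ((convex_singleton y).linear_preimage _)
  have hbound : ∀ w ∈ s, ‖deriv F w‖ ≤ g.toReal / 2 ^ k := by
    rintro w ⟨hw, rfl⟩
    have := ofReal_mul_enorm_deriv_le_dyadicCoeff hp hF hw.1 hw.2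
    have := ENNReal.toReal_mono hgt this
    rw [ENNReal.toReal_mul, ENNReal.toReal_ofReal h.le, toReal_enorm] at this
    rw [le_div_iff₀ h, mul_comm]
    exact this
  have hdiff : ∀ w ∈ s, DifferentiableAt ℂ F w := fun w hw => by
    refine hF.differentiableAt (isOpen_rightHalfPlane.mem_nhds ?_)
    have := hw.1.1
    simp only [rightHalfPlane, mem_ofPred_eq]
    linarith
  have hmv := hconv.norm_image_sub_le_of_norm_deriv_le hdiff hbound
    (show (⟨b, y⟩ : ℂ) ∈ s from ⟨hb, rfl⟩) (show (⟨a, y⟩ : ℂ) ∈ s from ⟨ha, rfl⟩)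
  have hab : ‖(⟨a, y⟩ : ℂ) - ⟨b, y⟩‖ ≤ 2 ^ k := by
    refine (Complex.norm_le_abs_re_add_abs_im _).trans ?_
    simp only [Complex.sub_re, Complex.sub_im, sub_self, abs_zero, add_zero, abs_le]
    exact ⟨by linarith [ha.1, hb.2], by linarith [ha.2, hb.1]⟩
  have hle : ‖F ⟨a, y⟩ - F ⟨b, y⟩‖ ≤ g.toReal := by
    refine hmv.trans ((mul_le_mul_of_nonneg_left hab (by positivity)).trans (le_of_eq ?_))
    field_simp
  have hle' : ‖F ⟨a, y⟩ - F ⟨b, y⟩‖ₑ ≤ g := by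
    rw [← ENNReal.ofReal_toReal hgt, ← ofReal_norm]
    exact ENNReal.ofReal_le_ofReal hle
  calc ‖F ⟨a, y⟩‖ₑ = ‖(F ⟨a, y⟩ - F ⟨b, y⟩) + F ⟨b, y⟩‖ₑ := by rw [sub_add_cancel]
    _ ≤ _ := (enorm_add_le _ _).trans (by gcongr)

/-- A holomorphic function vanishing at infinity along horizontal lines is dominated by the sum of
its coefficients over the dyadic boxes containing the point. -/
theorem enorm_le_tsum_dyadicCoeff {p : ℝ} (hp : 1 ≤ p) {F : ℂ → ℂ}
    (hF : DifferentiableOn ℂ F rightHalfPlane)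
    (hlim : ∀ y : ℝ, Tendsto (fun X : ℝ => ‖F ⟨X, y⟩‖ₑ) atTop (𝓝 0))
    {z : ℂ} (hz : z ∈ rightHalfPlane) :
    ‖F z‖ₑ ≤ ∑' i, (dyadicBox i).indicator (fun _ => dyadicCoeff p F i) z := by
  obtain ⟨n, hn1, hn2⟩ := exists_mem_Ico_zpow (show 0 < z.re from hz) one_lt_two
  -- The maximum makes the path start at Re z; x m and x (m + 1) both lie in [2^(n+m), 2^(n+m+1)],
  -- the top half of box i m.
  set x : ℕ → ℝ := fun m => max z.re (2 ^ (n + m)) with hx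
  set i : ℕ → ℤ × ℤ := fun m => (n + m + 1, ⌊z.im / 2 ^ (n + m + 1)⌋) with hi
  have hpow : ∀ m : ℤ, (2 : ℝ) ^ (m + 1) = 2 * 2 ^ m := fun m => by
    rw [zpow_add_one₀ two_ne_zero, mul_comm]
  have hxre : ∀ m : ℕ, z.re < 2 ^ (n + m + 1) := fun m =>
    hn2.trans_le (zpow_le_zpow_right₀ one_le_two (by lia))
  have hpartial : ∀ N : ℕ, ‖F z‖ₑ ≤
      ∑ m ∈ Finset.range N, dyadicCoeff p F (i m) + ‖F ⟨x N, z.im⟩‖ₑ := by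
    intro N
    induction N with
    | zero =>
      have : x 0 = z.re := by simpa [hx] using hn1
      simp [this]
    | succ N ih =>
      refine ih.trans ?_
      rw [Finset.sum_range_succ, add_assoc]
      gcongr
      refine enorm_le_dyadicCoeff_add hp hF ⟨?_, ?_⟩ ⟨?_, ?_⟩
      · rw [hpow]
        exact le_max_of_le_right (by linarith)
      · refine max_le (hxre N).le ?_
        rw [hpow]
        have : (0 : ℝ) < 2 ^ (n + N : ℤ) := by positivity
        linarith
      · refine le_max_of_le_right ?_
        push_cast
        rw [← add_assoc]
        have : (0 : ℝ) < 2 ^ (n + N + 1 : ℤ) := by positivity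
        linarith
      · refine max_le (hxre N).le ?_
        push_cast
        rw [← add_assoc]
  have hsum : ∀ N : ℕ, ∑ m ∈ Finset.range N, dyadicCoeff p F (i m)
      ≤ ∑' i, (dyadicBox i).indicator (fun _ => dyadicCoeff p F i) z := by
    intro N
    have hinj : Function.Injective i := fun m m' h => by
      have := congrArg Prod.fst h
      simpa [hi] using this
    calc ∑ m ∈ Finset.range N, dyadicCoeff p F (i m)
        = ∑ m ∈ Finset.range N,
            (dyadicBox (i m)).indicator (fun _ => dyadicCoeff p F (i m)) z := by
          refine Finset.sum_congr rfl fun m _ => ?_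
          rw [indicator_of_mem]
          exact ⟨(show 0 < z.re from hz).le, hxre m, rfl⟩
      _ ≤ ∑' m, (dyadicBox (i m)).indicator (fun _ => dyadicCoeff p F (i m)) z :=
          ENNReal.sum_le_tsum _
      _ ≤ _ := ENNReal.tsum_comp_le_tsum_of_injective hinj
          fun i => (dyadicBox i).indicator (fun _ => dyadicCoeff p F i) z
  have hxlim : Tendsto x atTop atTop := by
    refine tendsto_atTop_mono (fun m => le_max_right _ _) ?_
    have e : (fun m : ℕ => (2 : ℝ) ^ (n + m : ℤ)) = fun m : ℕ => 2 ^ n * 2 ^ m := by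
      funext m
      rw [zpow_add₀ two_ne_zero, zpow_natCast]
    rw [e]
    exact (tendsto_pow_atTop_atTop_of_one_lt one_lt_two).const_mul_atTop (by positivity)
  have := ((hlim z.im).comp hxlim).const_add
    (∑' i, (dyadicBox i).indicator (fun _ => dyadicCoeff p F i) z)
  rw [add_zero] at this
  exact ge_of_tendsto' this fun N => (hpartial N).trans (add_le_add_left (hsum N) _)

/-! ### Coefficients against the Besov integral. -/

/-- Applied to 2^k / Re z with exponent p - 2, whose sign is not fixed; hence the absolute value. -/
theorem Real.rpow_le_four_rpow_abs {x : ℝ} (h1 : 1 / 4 ≤ x) (h2 : x ≤ 4) (s : ℝ) :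
    x ^ s ≤ 4 ^ |s| := by
  rcases le_total 0 s with hs | hs
  · rw [abs_of_nonneg hs]
    exact Real.rpow_le_rpow (by linarith) h2 hs
  · rw [abs_of_nonpos hs]
    refine (Real.rpow_le_rpow_of_nonpos (by norm_num) h1 hs).trans (le_of_eq ?_)
    rw [one_div, Real.inv_rpow (by norm_num), Real.rpow_neg (by norm_num)]

/-- The weighted `ℓ^p` sum of the coefficients is controlled by the weighted Besov integral. -/
theorem exists_sum_dyadicCoeff_rpow_le {p : ℝ} (hp : 1 ≤ p) {ρ : ℂ → ℝ} (hρ : IsRegularWeight ρ) :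
    ∃ D : ℝ≥0, ∀ (F : ℂ → ℂ) (s : Finset (ℤ × ℤ)),
      ∑ i ∈ s, dyadicCoeff p F i ^ p * ENNReal.ofReal (ρ (dyadicCenter i))
        ≤ D * ∫⁻ z in rightHalfPlane,
            ‖deriv F z‖ₑ ^ p * ENNReal.ofReal (z.re ^ (p - 2) * ρ z) := by
  have hp0 : 0 < p := by linarith
  obtain ⟨δ, hδ, hcomp⟩ := hρ.exists_comparable_dyadic
  set D : ℝ := 16 / Real.pi * 4 ^ |p - 2| * δ with hD
  have hD0 : 0 < D := by positivity
  refine ⟨16 * D.toNNReal, fun F s => ?_⟩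
  -- The Besov weight frozen at the scale of the box; 16 / π comes from the area π (2^k / 4)^2.
  set κ : ℤ × ℤ → ℝ :=
    fun i => 16 / Real.pi * (2 ^ i.1) ^ (p - 2) * ρ (dyadicCenter i) with hκ
  have hterm : ∀ i, dyadicCoeff p F i ^ p * ENNReal.ofReal (ρ (dyadicCenter i))
      = ∫⁻ z, (dyadicNhd i).indicator (fun z => ‖deriv F z‖ₑ ^ p * ENNReal.ofReal (κ i)) z := by
    intro i
    have h : (0 : ℝ) < 2 ^ i.1 := by positivity
    have hpos := hρ.pos _ (dyadicCenter_mem i)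
    rw [lintegral_indicator (measurableSet_dyadicNhd i),
      lintegral_mul_const' _ _ ENNReal.ofReal_ne_top, dyadicCoeff,
      ENNReal.mul_rpow_of_nonneg _ _ hp0.le, ← ENNReal.rpow_mul, one_div_mul_cancel hp0.ne',
      ENNReal.rpow_one, ENNReal.ofReal_rpow_of_pos h, div_eq_mul_inv,
      ← ENNReal.ofReal_inv_of_pos (by positivity)]
    have e : κ i = (2 ^ i.1) ^ p * (((2 ^ i.1 / 4) ^ 2 * Real.pi)⁻¹ * ρ (dyadicCenter i)) := by
      simp only [hκ]
      rw [Real.rpow_sub h, Real.rpow_two]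
      field_simp
      norm_num
    rw [e, ENNReal.ofReal_mul (by positivity), ENNReal.ofReal_mul (by positivity)]
    ring
  have hpt : ∀ i, ∀ z ∈ dyadicNhd i, κ i ≤ D * (z.re ^ (p - 2) * ρ z) := by
    intro i z hz
    have h : (0 : ℝ) < 2 ^ i.1 := by positivity
    have hre : 0 < z.re := dyadicNhd_subset i hz
    have hρz := hρ.pos z (dyadicNhd_subset i hz)
    have hr : (2 ^ i.1) ^ (p - 2) ≤ 4 ^ |p - 2| * z.re ^ (p - 2) := by
      rw [← div_le_iff₀ (by positivity), ← Real.div_rpow h.le hre.le]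
      refine Real.rpow_le_four_rpow_abs ?_ ?_ _
      · rw [le_div_iff₀ hre]
        linarith [hz.2.1]
      · rw [div_le_iff₀ hre]
        linarith [hz.1]
    calc κ i ≤ 16 / Real.pi * (4 ^ |p - 2| * z.re ^ (p - 2)) * (δ * ρ z) := by
          refine mul_le_mul (by gcongr) (hcomp i z hz).2 (hρ.pos _ (dyadicCenter_mem i)).le ?_
          positivity
      _ = _ := by rw [hD]; ring
  have hm : Measurable fun z => ‖deriv F z‖ₑ ^ p := (measurable_deriv F).enorm.pow_const p
  rw [Finset.sum_congr rfl fun i _ => hterm i, ← lintegral_finsetSum _ fun i _ =>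
    (hm.mul_const _).indicator (measurableSet_dyadicNhd i),
    ← lintegral_const_mul' _ _ ENNReal.coe_ne_top,
    ← lintegral_indicator isOpen_rightHalfPlane.measurableSet]
  refine lintegral_mono fun z => ?_
  by_cases hz : z ∈ rightHalfPlane
  · rw [indicator_of_mem hz]
    refine le_trans (Finset.sum_le_sum fun i _ => ?_) ((sum_indicator_dyadicNhd_le s (fun z =>
      D.toNNReal * (‖deriv F z‖ₑ ^ p * ENNReal.ofReal (z.re ^ (p - 2) * ρ z))) z).trans
        (le_of_eq ?_))
    · by_cases hi : z ∈ dyadicNhd i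
      · rw [indicator_of_mem hi, indicator_of_mem hi, mul_left_comm]
        gcongr
        refine (ENNReal.ofReal_le_ofReal (hpt i z hi)).trans (le_of_eq ?_)
        rw [ENNReal.ofReal_mul hD0.le]
        rfl
      · simp [hi]
    · push_cast
      ring
  · rw [Finset.sum_eq_zero]
    · exact zero_le
    · exact fun i _ => indicator_of_notMem (fun hi => hz (dyadicNhd_subset i hi)) _

/-! ### Assembly. -/

/-- The n = 0 term alone gives the decay of F. -/
theorem zenNormPow_zero_le_genZenNormPow (p : ℝ) (m : ℕ∞) (ν : ℕ → Measure ℝ≥0) (F : ℂ → ℂ) :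
    zenNormPow p (ν 0) F ≤ genZenNormPow p m ν F := by
  have := ENNReal.le_tsum (f := fun n : {n : ℕ // (n : ℕ∞) ≤ m} =>
    zenNormPow p (ν n) (iteratedDeriv n F)) ⟨0, by simp⟩
  rw [genZenNormPow]
  simpa only [iteratedDeriv_zero] using this

/-- Monotone convergence, to reach all boxes from the finite sums of the tree theorem. -/
theorem lintegral_tsum_rpow_eq_iSup {ι X : Type*} [Countable ι] [MeasurableSpace X] (μ : Measure X)
    {f : ι → X → ℝ≥0∞} (hf : ∀ i, Measurable (f i)) {q : ℝ} (hq : 0 < q) :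
    ∫⁻ x, (∑' i, f i x) ^ q ∂μ = ⨆ s : Finset ι, ∫⁻ x, (∑ i ∈ s, f i x) ^ q ∂μ := by
  classical
  rw [← lintegral_iSup_directed]
  · refine lintegral_congr fun x => ?_
    rw [ENNReal.tsum_eq_iSup_sum]
    exact (ENNReal.orderIsoRpow q hq).map_iSup _
  · exact fun s => ((Finset.measurable_sum s fun i _ => hf i).pow_const q).aemeasurable
  · refine directed_of_isDirected_le fun s t hst x => ?_
    exact ENNReal.rpow_le_rpow (Finset.sum_le_sum_of_subset hst) hq.le

end Embedding

theorem mainTheorem4 (p q : ℝ) (hp : 1 < p) (hpq : p ≤ q)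
    (m : ℕ∞) (ν : ℕ → Measure ℝ≥0) (hν : ∀ n : ℕ, (n : ℕ∞) ≤ m → IsDelta2Measure (ν n))
    (μ : Measure ℂ) (hμ : μ rightHalfPlaneᶜ = 0)
    (hμfin : ∀ a ∈ rightHalfPlane, μ (carlesonSquare a) < ∞)
    (ρ : ℂ → ℝ) (hρ : IsRegularWeight ρ)
    (hBesov : ∀ F ∈ genZenSpace p m ν,
      ∫⁻ z in rightHalfPlane, ‖deriv F z‖ₑ ^ p * ENNReal.ofReal (z.re ^ (p - 2) * ρ z)
        ≤ genZenNormPow p m ν F)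
    (hTree : ∃ C : ℝ≥0, ∀ a ∈ rightHalfPlane,
      (∫⁻ z in carlesonSquare a,
          μ (carlesonSquare a ∩ carlesonSquare z) ^ p.conjExponent
            * ENNReal.ofReal (ρ z ^ (1 - p.conjExponent) / z.re ^ 2))
        ^ (q.conjExponent / p.conjExponent) ≤ C * μ (carlesonSquare a)) :
    ∃ K : ℝ≥0, ∀ F ∈ genZenSpace p m ν,
      MemLp F (ENNReal.ofReal q) μ ∧
        eLpNorm F (ENNReal.ofReal q) μ ≤ K * genZenNorm p m ν F := by

  have hq : 1 < q := by linarith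
  have hq0 : 0 < q := by linarith
  have hp0 : 0 < p := by linarith
  have hp'0 : 0 < p.conjExponent := (Real.HolderConjugate.conjExponent hp).symm.pos
  obtain ⟨C, hC⟩ := exists_dyadic_testing hp hq hμfin hρ hTree
  obtain ⟨D, hD⟩ := exists_sum_dyadicCoeff_rpow_le hp.le hρ
  set L : ℝ≥0∞ := ENNReal.ofReal q *
    (ENNReal.ofReal ((q - 1) * p.conjExponent) * C) ^ (1 / p.conjExponent) with hL
  have hLtop : L ≠ ∞ := ENNReal.mul_ne_top ENNReal.ofReal_ne_top
    (ENNReal.rpow_ne_top_of_nonneg (by positivity)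
      (ENNReal.mul_ne_top ENNReal.ofReal_ne_top ENNReal.coe_ne_top))
  have hKtop : L * (D : ℝ≥0∞) ^ (1 / p) ≠ ∞ := ENNReal.mul_ne_top hLtop
    (ENNReal.rpow_ne_top_of_nonneg (by positivity) ENNReal.coe_ne_top)
  refine ⟨(L * (D : ℝ≥0∞) ^ (1 / p)).toNNReal, fun F hF => ?_⟩
  rw [ENNReal.coe_toNNReal hKtop]
  obtain ⟨hFd, hFfin⟩ := hF
  have hμr : μ.restrict rightHalfPlane = μ :=
    Measure.restrict_eq_self_of_ae_mem (mem_ae_iff.2 hμ)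
  have hmeas : AEStronglyMeasurable F μ := by
    rw [← hμr]
    exact hFd.continuousOn.aestronglyMeasurable isOpen_rightHalfPlane.measurableSet
  have hlim := tendsto_zero_of_zenNormPow_lt_top hp.le (hν 0 (by simp)) hFd
    ((zenNormPow_zero_le_genZenNormPow p m ν F).trans_lt hFfin)
  have hsum : ∀ s : Finset (ℤ × ℤ),
      ∑ i ∈ s, dyadicCoeff p F i ^ p * ENNReal.ofReal (ρ (dyadicCenter i))
        ≤ D * genZenNormPow p m ν F := fun s =>
    (hD F s).trans (mul_le_mul_right (hBesov F ⟨hFd, hFfin⟩) _)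
  have hw0 : ∀ i, ENNReal.ofReal (ρ (dyadicCenter i)) ≠ 0 := fun i => by
    simpa using hρ.pos _ (dyadicCenter_mem i)
  -- An infinite coefficient would make its one-term weighted sum infinite, since the weight is
  -- positive.
  have hG : ∀ i, dyadicCoeff p F i ≠ ∞ := by
    intro i hi
    have := hsum {i}
    rw [Finset.sum_singleton, hi, ENNReal.top_rpow_of_pos hp0, ENNReal.top_mul (hw0 i)] at this
    exact (ENNReal.mul_ne_top ENNReal.coe_ne_top hFfin.ne) (top_le_iff.1 this)
  have hbound : eLpNorm F (ENNReal.ofReal q) μ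
      ≤ L * (D : ℝ≥0∞) ^ (1 / p) * genZenNorm p m ν F := by
    rw [eLpNorm_eq_lintegral_rpow_enorm_toReal (by simpa using hq0) ENNReal.ofReal_ne_top,
      ENNReal.toReal_ofReal hq0.le, one_div, ENNReal.rpow_inv_le_iff hq0]
    calc ∫⁻ z, ‖F z‖ₑ ^ q ∂μ
        ≤ ∫⁻ z, (∑' i, (dyadicBox i).indicator (fun _ => dyadicCoeff p F i) z) ^ q ∂μ := by
          refine lintegral_mono_ae ?_
          filter_upwards [mem_ae_iff.2 hμ] with z hz
          exact ENNReal.rpow_le_rpow (enorm_le_tsum_dyadicCoeff hp.le hFd hlim hz) hq0.le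
      _ = ⨆ s : Finset (ℤ × ℤ), ∫⁻ z,
            (∑ i ∈ s, (dyadicBox i).indicator (fun _ => dyadicCoeff p F i) z) ^ q ∂μ :=
          lintegral_tsum_rpow_eq_iSup μ
            (fun i => measurable_const.indicator (measurableSet_dyadicBox i)) hq0
      _ ≤ _ := by
          refine iSup_le fun s => ?_
          rw [← ENNReal.rpow_inv_le_iff hq0, ← one_div]
          refine (lintegral_tree_sum_rpow_le hp hpq μ dyadicBox Prod.fst measurableSet_dyadicBox
            dyadicBox_nonempty (fun i => (measure_dyadicBox_lt_top hμfin i).ne)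
            (fun i j x hi hj h => dyadicBox_subset hi hj h) _ hw0
            (fun _ => ENNReal.ofReal_ne_top) C hC s _ hG).trans ?_
          rw [mul_assoc L, genZenNorm, ← ENNReal.mul_rpow_of_nonneg _ _ (by positivity)]
          gcongr
          exact hsum s
  refine ⟨⟨hmeas, hbound.trans_lt ?_⟩, hbound⟩
  exact (ENNReal.mul_ne_top hKtop
    (ENNReal.rpow_ne_top_of_nonneg (by positivity) hFfin.ne)).lt_top
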